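/- Let $R>0$, $L_d>0$, let $\Omega_R=\{x\in\mathbb{R}^3:|x|=R\}$ with its surface measure $dS$ (total mass $4\pi R^2$), and let $\nabla_s^2$ be the Laplace–Beltrami operator of $\Omega_R$; in colatitude $\theta$ and longitude $\varphi$, $$\nabla_s^2=\frac{1}{R^2\sin^2\theta}\frac{\partial^2}{\partial\varphi^2}+\frac{1}{R^2\sin\theta}\frac{\partial}{\partial\theta}\Big(\sin\theta\frac{\partial}{\partial\theta}\Big).$$ For $x,y\in\Omega_R$ let $\gamma\in[0,\pi]$ be the central angle between $x$ and $y$, and let $P_l$ be the Legendre polynomials. A Green's function of the screened Poisson equation $$\nabla_s^2\psi-\frac{1}{L_d^2}\psi=f\quad\text{on }\Omega_R \qquad (*)$$ is a function $G:\Omega_R\times\Omega_R\to\mathbb{R}$ such that, for every source $y$, $G(\cdot,y)$ is continuous on $\Omega_R\setminus\{y\}$, integrable on $\Omega_R$, and $$\int_{\Omega_R}G(x,y)\Big(\nabla_s^2v(x)-\frac{v(x)}{L_d^2}\Big)dS(x)=v(y)\quad\text{for all }v\in C^\infty(\Omega_R)$$ (that is, $\nabla_s^2G(\cdot,y)-G(\cdot,y)/L_d^2=\delta_y$).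 A weak solution of $(*)$ for $f\in L^2(\Omega_R)$ is a $\psi\in L^2(\Omega_R)$ with $\int_{\Omega_R}\psi\,(\nabla_s^2v-v/L_d^2)\,dS=\int_{\Omega_R}fv\,dS$ for all $v\in C^\infty(\Omega_R)$. Then equation $(*)$ has a Green's function $G$, unique off the diagonal $x=y$, and: 1. for every $f\in L^2(\Omega_R)$ the function $\psi(x)=\int_{\Omega_R}G(x,y)f(y)\,dS(y)$ is well defined for every $x$ (the integrand is integrable) and is the unique weak solution of $(*)$, up to equality almost everywhere; moreover, if $\psi\in C^2(\Omega_R)$ satisfies $(*)$ pointwise, then $\psi(x)=\int_{\Omega_R}G(x,y)f(y)\,dS(y)$ for every $x\in\Omega_R$; 2. for all $x\ne y$ the following series converges (as the limit of its partial sums) and $$G(x,y)=-\frac{1}{4\pi}\sum_{l=0}^{\infty}\frac{2l+1}{l(l+1)+R^2/L_d^2}\,P_l(\cos\gamma);$$ 3. for $x=y$ (so $\cos\gamma=1$) the partial sums of $-\frac{1}{4\pi}\sum_{l}\frac{2l+1}{l(l+1)+R^2/L_d^2}P_l(1)$ tend to $-\infty$. -/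

import Mathlib

open Filter Topology MeasureTheory Metric
open scoped ContDiff

/-- Euclidean three-space. -/
abbrev E3 : Type := EuclideanSpace ℝ (Fin 3)

/-- The sphere of radius `R` in three-space, centred at the origin. -/
abbrev Sph (R : ℝ) : Type := sphere (0 : E3) R

/-- The surface measure `dS` of the sphere of radius `R` (total mass `4 π R ^ 2`): the image of the
surface measure of the unit sphere under `ξ ↦ R ξ`, multiplied by `R ^ 2`. -/
noncomputable def surfaceMeasure (R : ℝ) : Measure (Sph R) :=
  ENNReal.ofReal (R ^ 2) •
    ((volume : Measure E3).toSphere.map (fun ξ : Sph 1 => R • (ξ : E3))).comap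
      ((↑) : Sph R → E3)

/-- The extension of a function on the sphere of radius `R` that is constant along rays,
`x ↦ u (R x / ‖x‖)` for `x ≠ 0` (the value at `0` is irrelevant). -/
noncomputable def radialExtension (R : ℝ) (u : Sph R → ℝ) : E3 → ℝ :=
  fun x => Function.extend ((↑) : Sph R → E3) u 0 ((R / ‖x‖) • x)

/-- `u` is of class `C^n` on the sphere of radius `R`. -/
def SphereContDiff (R : ℝ) (n : WithTop ℕ∞) (u : Sph R → ℝ) : Prop :=
  ContDiffOn ℝ n (radialExtension R u) {0}ᶜ

/-- The Laplace-Beltrami operator of the sphere of radius `R`: the Euclidean Laplacian of the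
extension that is constant along rays, restricted to the sphere. Its expression in spherical
coordinates is `laplaceBeltrami_sphPoint` below. -/
noncomputable def laplaceBeltrami (R : ℝ) (u : Sph R → ℝ) : Sph R → ℝ :=
  fun x => Laplacian.laplacian (radialExtension R u) (x : E3)

/-- The Legendre polynomial `P_l`, by Rodrigues' formula. -/
noncomputable def legendreP (l : ℕ) : Polynomial ℝ :=
  Polynomial.C (1 / (2 ^ l * (l.factorial : ℝ))) *
    Polynomial.derivative^[l] ((Polynomial.X ^ 2 - 1) ^ l)

/-- The central angle `γ` between two points of the sphere. -/
noncomputable def centralAngle {R : ℝ} (x y : Sph R) : ℝ :=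
  InnerProductGeometry.angle (x : E3) (y : E3)

/-- The sum of the terms `l < N` of the series
`-(1 / 4π) ∑ (2l + 1) / (l (l + 1) + R² / L²) P_l (cos γ)`. -/
noncomputable def greenPartialSum (R L : ℝ) (N : ℕ) (x y : Sph R) : ℝ :=
  -(1 / (4 * Real.pi)) * ∑ l ∈ Finset.range N,
    (2 * (l : ℝ) + 1) / ((l : ℝ) * ((l : ℝ) + 1) + R ^ 2 / L ^ 2) *
      (legendreP l).eval (Real.cos (centralAngle x y))

/-- `ψ` is a square-integrable weak solution of `∇² ψ - ψ / L² = f` on the sphere of radius `R`. -/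
def IsWeakSolution (R L : ℝ) (f ψ : Sph R → ℝ) : Prop :=
  MemLp ψ 2 (surfaceMeasure R) ∧
    ∀ v : Sph R → ℝ, SphereContDiff R ∞ v →
      ∫ x, ψ x * (laplaceBeltrami R v x - v x / L ^ 2) ∂(surfaceMeasure R) =
        ∫ x, f x * v x ∂(surfaceMeasure R)

/-- `G` is a Green's function of `∇² ψ - ψ / L² = f` on the sphere of radius `R`: for each source
`y`, `G · y` is integrable, continuous away from `y`, and `∇² G - G / L² = δ_y` holds in the sense
of distributions. The values `G y y` play no role. -/
structure IsGreenFunction (R L : ℝ) (G : Sph R → Sph R → ℝ) : Prop where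
  continuousOn : ∀ y, ContinuousOn (fun x => G x y) {y}ᶜ
  integrable : ∀ y, Integrable (fun x => G x y) (surfaceMeasure R)
  delta : ∀ y, ∀ v : Sph R → ℝ, SphereContDiff R ∞ v →
    ∫ x, G x y * (laplaceBeltrami R v x - v x / L ^ 2) ∂(surfaceMeasure R) = v y

/-- The point of the sphere of radius `R` with colatitude `θ` and longitude `φ`. -/
noncomputable def sphPoint (R : ℝ) (hR : 0 ≤ R) (θ φ : ℝ) : Sph R :=
  ⟨!₂[R * (Real.sin θ * Real.cos φ), R * (Real.sin θ * Real.sin φ), R * Real.cos θ], by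
    rw [mem_sphere_zero_iff_norm, EuclideanSpace.norm_eq, Fin.sum_univ_three]
    simp only [Real.norm_eq_abs, sq_abs, Matrix.cons_val_zero,
      Matrix.cons_val_one, Matrix.cons_val]
    rw [show (R * (Real.sin θ * Real.cos φ)) ^ 2 + (R * (Real.sin θ * Real.sin φ)) ^ 2 +
      (R * Real.cos θ) ^ 2 = R ^ 2 by
        linear_combination R ^ 2 * Real.sin θ ^ 2 * Real.sin_sq_add_cos_sq φ +
          R ^ 2 * Real.sin_sq_add_cos_sq θ, Real.sqrt_sq hR]⟩

lemma radialExtension_coe {R : ℝ} (hR : 0 < R) (u : Sph R → ℝ) (x : Sph R) :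
    radialExtension R u x = u x := by
  have h : ‖(x : E3)‖ = R := mem_sphere_zero_iff_norm.1 x.2
  unfold radialExtension
  rw [h, div_self hR.ne', one_smul]
  exact Subtype.val_injective.extend_apply u 0 x

lemma radialExtension_smul (R : ℝ) (u : Sph R → ℝ) (x : E3) {t : ℝ} (ht : 0 < t) :
    radialExtension R u (t • x) = radialExtension R u x := by
  unfold radialExtension
  rw [norm_smul, Real.norm_of_nonneg ht.le, smul_smul]
  congr 2
  rcases eq_or_ne ‖x‖ 0 with h | h
  · simp [h]
  · field_simp

lemma hasDerivAt_comp_curve {Φ : E3 → ℝ} {c c₁ : ℝ → E3} {c₂ : E3} {t : ℝ}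
    (hΦ : ContDiffAt ℝ 2 Φ (c t)) (h₁ : HasDerivAt c (c₁ t) t) (h₂ : HasDerivAt c₁ c₂ t) :
    HasDerivAt (fun s => fderiv ℝ Φ (c s) (c₁ s))
      (iteratedFDeriv ℝ 2 Φ (c t) ![c₁ t, c₁ t] + fderiv ℝ Φ (c t) c₂) t := by
  have hd : DifferentiableAt ℝ (fderiv ℝ Φ) (c t) :=
    (hΦ.fderiv_right (m := 1) (by norm_num)).differentiableAt (by norm_num)
  have := (hd.hasFDerivAt.comp_hasDerivAt t h₁).clm_apply h₂
  rw [iteratedFDeriv_two_apply]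
  simpa using this

lemma hasDerivAt_comp_curve₁ {Φ : E3 → ℝ} {c : ℝ → E3} {v : E3} {t : ℝ}
    (hΦ : ContDiffAt ℝ 2 Φ (c t)) (h₁ : HasDerivAt c v t) :
    HasDerivAt (fun s => Φ (c s)) (fderiv ℝ Φ (c t) v) t :=
  (hΦ.differentiableAt (by norm_num)).hasFDerivAt.comp_hasDerivAt t h₁

lemma orthonormal_sphFrame (θ φ : ℝ) : Orthonormal ℝ
    ![(!₂[Real.sin θ * Real.cos φ, Real.sin θ * Real.sin φ, Real.cos θ] : E3),
      !₂[Real.cos θ * Real.cos φ, Real.cos θ * Real.sin φ, -Real.sin θ],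
      !₂[-Real.sin φ, Real.cos φ, 0]] := by
  have s1 := Real.sin_sq_add_cos_sq θ
  have s2 := Real.sin_sq_add_cos_sq φ
  rw [orthonormal_iff_ite]
  intro i j
  rw [PiLp.inner_apply, Fin.sum_univ_three]
  fin_cases i <;> fin_cases j <;> simp <;> grind

/-- In spherical coordinates (colatitude `θ`, longitude `φ`) and away from the poles,
`∇² = 1 / (R² sin² θ) ∂²/∂φ² + 1 / (R² sin θ) ∂/∂θ (sin θ ∂/∂θ)`. -/
theorem laplaceBeltrami_sphPoint {R : ℝ} (hR : 0 < R) {u : Sph R → ℝ}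
    (hu : SphereContDiff R 2 u) {θ φ : ℝ} (hθ : Real.sin θ ≠ 0) :
    laplaceBeltrami R u (sphPoint R hR.le θ φ) =
      1 / R ^ 2 * (1 / Real.sin θ ^ 2) *
          deriv (fun p => deriv (fun q => u (sphPoint R hR.le θ q)) p) φ +
        1 / R ^ 2 * (1 / Real.sin θ) *
          deriv (fun s => Real.sin s * deriv (fun r => u (sphPoint R hR.le r φ)) s) θ := by
  set Φ := radialExtension R u with hΦdef
  have hne : ∀ a b, (sphPoint R hR.le a b : E3) ≠ 0 := fun a b h => by
    have := mem_sphere_zero_iff_norm.1 (sphPoint R hR.le a b).2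
    rw [h, norm_zero] at this
    exact hR.ne this
  have hC : ∀ a b, ContDiffAt ℝ 2 Φ (sphPoint R hR.le a b) := fun a b =>
    hu.contDiffAt (isOpen_compl_singleton.mem_nhds (hne a b))
  let P : ℝ → ℝ → E3 := fun a b =>
    !₂[R * (Real.sin a * Real.cos b), R * (Real.sin a * Real.sin b), R * Real.cos a]
  have hP : ∀ a b, (sphPoint R hR.le a b : E3) = P a b := fun _ _ => rfl
  let er : ℝ → ℝ → E3 := fun a b =>
    !₂[Real.sin a * Real.cos b, Real.sin a * Real.sin b, Real.cos a]
  let et : ℝ → ℝ → E3 := fun a b =>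
    !₂[Real.cos a * Real.cos b, Real.cos a * Real.sin b, -Real.sin a]
  let ep : ℝ → E3 := fun b => !₂[-Real.sin b, Real.cos b, 0]
  let eq : ℝ → E3 := fun b => !₂[Real.cos b, Real.sin b, 0]
  have vec : ∀ (f : ℝ → E3) (f' : E3) (t : ℝ),
      (∀ i, HasDerivAt (fun s => f s i) (f' i) t) → HasDerivAt f f' t := by
    intro f f' t h
    rw [hasDerivAt_iff_hasFDerivAt, ← hasFDerivWithinAt_univ, hasFDerivWithinAt_euclidean]
    intro i
    refine ((h i).hasFDerivAt.congr_fderiv ?_).hasFDerivWithinAt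
    ext
    simp
  -- derivatives of the coordinate curves
  have dP_t : ∀ a b, HasDerivAt (fun s => P s b) (R • et a b) a := by
    intro a b
    refine vec _ _ _ fun i => ?_
    fin_cases i
    · simpa [P, et] using ((Real.hasDerivAt_sin a).mul_const (Real.cos b)).const_mul R
    · simpa [P, et] using ((Real.hasDerivAt_sin a).mul_const (Real.sin b)).const_mul R
    · simpa [P, et] using (Real.hasDerivAt_cos a).const_mul R
  have det_t : ∀ a b, HasDerivAt (fun s => R • et s b) (-(R • er a b)) a := by
    intro a b
    refine vec _ _ _ fun i => ?_
    fin_cases i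
    · simpa [er, et] using ((Real.hasDerivAt_cos a).mul_const (Real.cos b)).const_mul R
    · simpa [er, et] using ((Real.hasDerivAt_cos a).mul_const (Real.sin b)).const_mul R
    · simpa [er, et] using (Real.hasDerivAt_sin a).neg.const_mul R
  have dP_p : ∀ a b, HasDerivAt (fun s => P a s) ((R * Real.sin a) • ep b) b := by
    intro a b
    refine vec _ _ _ fun i => ?_
    fin_cases i
    · simpa [P, ep, mul_assoc] using
        ((Real.hasDerivAt_cos b).const_mul (Real.sin a)).const_mul R
    · simpa [P, ep, mul_assoc] using
        ((Real.hasDerivAt_sin b).const_mul (Real.sin a)).const_mul R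
    · simpa [P, ep] using hasDerivAt_const b (R * Real.cos a)
  have dep : ∀ a b, HasDerivAt (fun s => (R * Real.sin a) • ep s)
      (-((R * Real.sin a) • eq b)) b := by
    intro a b
    refine vec _ _ _ fun i => ?_
    fin_cases i
    · simpa [eq, ep] using (Real.hasDerivAt_sin b).neg.const_mul (R * Real.sin a)
    · simpa [eq, ep] using (Real.hasDerivAt_cos b).const_mul (R * Real.sin a)
    · simpa [eq, ep] using hasDerivAt_const b (0 : ℝ)
  have heq : eq φ = Real.sin θ • er θ φ + Real.cos θ • et θ φ := by
    ext i
    fin_cases i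
    · simp [eq, er, et]
      linear_combination (-Real.cos φ) * Real.sin_sq_add_cos_sq θ
    · simp [eq, er, et]
      linear_combination (-Real.sin φ) * Real.sin_sq_add_cos_sq θ
    · simp [eq, er, et]; ring
  -- the radial derivatives vanish
  have dray : ∀ t : ℝ, 0 < t → HasDerivAt (fun s : ℝ => s • er θ φ) (er θ φ) t := by
    intro t _
    simpa using (hasDerivAt_id t).smul_const (er θ φ)
  have hPR : P θ φ = R • er θ φ := by
    ext i
    fin_cases i <;> simp [P, er]
  have hern : er θ φ ≠ 0 := fun h => hne θ φ (by rw [hP, hPR, h, smul_zero])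
  have hCr : ∀ t : ℝ, 0 < t → ContDiffAt ℝ 2 Φ (t • er θ φ) := fun t ht =>
    hu.contDiffAt (isOpen_compl_singleton.mem_nhds (smul_ne_zero ht.ne' hern))
  have hr1 : ∀ t : ℝ, 0 < t → fderiv ℝ Φ (t • er θ φ) (er θ φ) = 0 := by
    intro t ht
    refine (hasDerivAt_comp_curve₁ (c := fun s : ℝ => s • er θ φ) (hCr t ht)
      (dray t ht)).unique ?_
    refine (hasDerivAt_const t (Φ (er θ φ))).congr_of_eventuallyEq ?_
    filter_upwards [lt_mem_nhds ht] with s hs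
    exact radialExtension_smul R u _ hs
  have hr2 : iteratedFDeriv ℝ 2 Φ (P θ φ) ![er θ φ, er θ φ] = 0 := by
    have h := hasDerivAt_comp_curve (c := fun s : ℝ => s • er θ φ) (c₁ := fun _ => er θ φ)
      (hCr R hR) (dray R hR) (hasDerivAt_const R (er θ φ))
    rw [hPR]
    have h0 : HasDerivAt (fun s : ℝ => fderiv ℝ Φ (s • er θ φ) (er θ φ)) 0 R := by
      refine (hasDerivAt_const R (0 : ℝ)).congr_of_eventuallyEq ?_
      filter_upwards [lt_mem_nhds hR] with s hs
      exact hr1 s hs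
    simpa using h.unique h0
  have hr1' : fderiv ℝ Φ (P θ φ) (er θ φ) = 0 := by rw [hPR]; exact hr1 R hR
  -- the two second derivatives along coordinate curves
  have huP : ∀ a b, u (sphPoint R hR.le a b) = Φ (P a b) := fun a b =>
    (radialExtension_coe hR u _).symm
  have hCP : ∀ a b, ContDiffAt ℝ 2 Φ (P a b) := hC
  have hA : deriv (fun p => deriv (fun q => u (sphPoint R hR.le θ q)) p) φ =
      (R * Real.sin θ) ^ 2 * iteratedFDeriv ℝ 2 Φ (P θ φ) ![ep φ, ep φ] -
        R * Real.sin θ * Real.cos θ * fderiv ℝ Φ (P θ φ) (et θ φ) := by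
    have h1 : (fun p => deriv (fun q => u (sphPoint R hR.le θ q)) p) =
        fun p => fderiv ℝ Φ (P θ p) ((R * Real.sin θ) • ep p) := by
      funext p
      simp only [huP]
      exact (hasDerivAt_comp_curve₁ (c := fun s => P θ s) (hCP θ p) (dP_p θ p)).deriv
    rw [h1, (hasDerivAt_comp_curve (c := fun s => P θ s) (hCP θ φ) (dP_p θ φ)
      (dep θ φ)).deriv, heq]
    simp only [iteratedFDeriv_two_apply, Matrix.cons_val_zero, Matrix.cons_val_one, map_smul,
      map_neg, map_add, hr1', smul_eq_mul, smul_apply]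
    ring
  have hB : deriv (fun s => Real.sin s * deriv (fun r => u (sphPoint R hR.le r φ)) s) θ =
      Real.cos θ * (R * fderiv ℝ Φ (P θ φ) (et θ φ)) +
        Real.sin θ * (R ^ 2 * iteratedFDeriv ℝ 2 Φ (P θ φ) ![et θ φ, et θ φ]) := by
    have h1 : (fun s => Real.sin s * deriv (fun r => u (sphPoint R hR.le r φ)) s) =
        fun s => Real.sin s * fderiv ℝ Φ (P s φ) (R • et s φ) := by
      funext s
      simp only [huP]
      rw [(hasDerivAt_comp_curve₁ (c := fun s => P s φ) (hCP s φ) (dP_t s φ)).deriv]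
    have h2 := (Real.hasDerivAt_sin θ).mul (hasDerivAt_comp_curve (c := fun s => P s φ)
      (hCP θ φ) (dP_t θ φ) (det_t θ φ))
    rw [h1]
    refine h2.deriv.trans ?_
    simp only [iteratedFDeriv_two_apply, Matrix.cons_val_zero, Matrix.cons_val_one, map_smul,
      map_neg, hr1', smul_eq_mul, smul_apply]
    ring
  -- the Laplacian in the moving frame
  have hon : Orthonormal ℝ ![er θ φ, et θ φ, ep φ] := orthonormal_sphFrame θ φ
  let B : OrthonormalBasis (Fin 3) ℝ E3 := OrthonormalBasis.mk hon (by
    rw [LinearIndependent.span_eq_top_of_card_eq_finrank hon.linearIndependent (by simp)])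
  have hL : Laplacian.laplacian Φ (P θ φ) =
      iteratedFDeriv ℝ 2 Φ (P θ φ) ![et θ φ, et θ φ] +
        iteratedFDeriv ℝ 2 Φ (P θ φ) ![ep φ, ep φ] := by
    rw [InnerProductSpace.laplacian_eq_iteratedFDeriv_orthonormalBasis Φ B]
    simp only [Fin.sum_univ_three]
    simp only [B, OrthonormalBasis.coe_mk, Matrix.cons_val_zero, Matrix.cons_val_one,
      Matrix.cons_val]
    rw [hr2, zero_add]
  unfold laplaceBeltrami
  rw [hA, hB]
  change Laplacian.laplacian Φ (P θ φ) = _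
  rw [hL]
  have hR' := hR.ne'
  field_simp
  ring

/-!
With `c = R² / L²` and `a_l = 1 / (l (l + 1) + c)`, the Green's function is the zonal function whose
Legendre series is `-(1 / 4π) ∑ (2l + 1) a_l P_l(t)`, `t = cos γ`. The proof has four ingredients.

*The series.* Bonnet's recurrence says that `(1 - t) (2l + 1) P_l` is the increment of the flux
`l (P_{l-1} - P_l)`. Summation by parts (`one_sub_mul_sum_greenCoeff`) therefore turns `1 - t` times
the series into `∑ (a_l - a_{l+1}) (l + 1) (P_l - P_{l+1})`, which converges uniformly on `[-1, 1]`
because `|P_l| ≤ 1`. This gives convergence and continuity off the diagonal, including at `t = -1`.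
At `t = 1` the original series is comparable to the harmonic series.

*Orthogonality.* Spherical coordinates about an arbitrary orthonormal frame
(`lintegral_toSphere_eq_spherical`) reduce integrals of products of zonal polynomials to integrals
over `[-1, 1]`, since the average of a zonal polynomial over circles of latitude about another pole
is a polynomial of no larger degree. This yields `∫ P_k(x·y) P_l(x·z) dS(x) = 0` for `k ≠ l` and the
reproducing formula for `k = l`. By Fatou's lemma the partial sums converge to the Green's function
in `L²`, and `∫ G(x, y) P_l(x·z) dS(x) = -R² a_l P_l(y·z)`. As `P_l(x·z)` is an eigenfunction of the
Laplace-Beltrami operator (`laplaceBeltrami_zonal`), the Green's function inverts the screened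
Laplacian on zonal harmonics.

*Density and the maximum principle.* The zonal harmonics span a dense subspace of the continuous
functions, because its closure contains the functions `exp ⟪w, x⟫`, whose span is an algebra that
separates points (`topologicalClosure_zonalSpan`). If `v` is of class `C²` and zonal sums `h_n` tend
uniformly to `∇² v - v / L²`, the zonal solutions for the right-hand sides `h_n` tend uniformly to
`v` by the maximum principle (`abs_le_of_abs_screened_le`). Hence the Green's representation holds
for every `v` of class `C²` (`integral_greenFunction_mul_screened`).

*Uniqueness.* The range of the screened Laplacian on smooth functions is uniformly dense, so an
integrable function orthogonal to it vanishes almost everywhere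
(`ae_eq_zero_of_forall_integral_mul_screened`). Applied to differences, this gives the uniqueness of
the Green's function and of weak solutions. Existence of weak solutions is Fubini's theorem.
-/

/-! ### Legendre polynomials -/

section Legendre

open Polynomial

/-- The antiderivative `∂^n (X² - 1)^(n+1) / (2^(n+1) (n+1)!)` of `P_{n+1}` that vanishes
at `±1`. -/
noncomputable def legendreAntideriv (n : ℕ) : ℝ[X] :=
  C (1 / (2 ^ (n + 1) * ((n + 1).factorial : ℝ))) * derivative^[n] ((X ^ 2 - 1) ^ (n + 1))

lemma derivative_legendreAntideriv (n : ℕ) :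
    derivative (legendreAntideriv n) = legendreP (n + 1) := by
  rw [legendreAntideriv, legendreP, derivative_C_mul,
    ← Function.iterate_succ_apply' (f := derivative)]

lemma derivative_sq_sub_one_pow (n : ℕ) :
    derivative ((X ^ 2 - 1 : ℝ[X]) ^ (n + 1)) = C (2 * ((n : ℝ) + 1)) * (X * (X ^ 2 - 1) ^ n) := by
  rw [derivative_pow_succ]
  simp only [derivative_sub, derivative_X_pow, derivative_one, map_add, map_mul, map_natCast,
    map_one, map_ofNat, Nat.cast_ofNat, Nat.add_one_sub_one, pow_one, sub_zero]
  ring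

lemma derivative_derivative_sq_sub_one_pow (n : ℕ) :
    derivative (derivative ((X ^ 2 - 1 : ℝ[X]) ^ (n + 2))) =
      C (2 * ((n : ℝ) + 2)) * (C (2 * (n : ℝ) + 3) * (X ^ 2 - 1) ^ (n + 1) +
        C (2 * ((n : ℝ) + 1)) * (X ^ 2 - 1) ^ n) := by
  have h := derivative_sq_sub_one_pow (n + 1)
  push_cast at h
  rw [show n + 2 = n + 1 + 1 from rfl, h, derivative_C_mul, derivative_mul, derivative_X,
    derivative_sq_sub_one_pow n]
  simp only [map_add, map_mul, map_natCast, map_one, map_ofNat]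
  ring

lemma legendreP_zero : legendreP 0 = 1 := by simp [legendreP]

lemma legendreP_one : legendreP 1 = X := by
  simp only [legendreP, pow_one, Function.iterate_one, derivative_sub, derivative_X_pow,
    derivative_one, Nat.factorial_one, sub_zero]
  rw [← mul_assoc]
  simp [← C_mul]

lemma legendreP_add_two_eq_X_mul (n : ℕ) :
    legendreP (n + 2) = X * legendreP (n + 1) + C ((n : ℝ) + 1) * legendreAntideriv n := by
  have h := derivative_sq_sub_one_pow (n + 1)
  push_cast at h
  have hf : ((n + 2).factorial : ℝ) = (n + 2) * (n + 1).factorial := by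
    rw [show n + 2 = n + 1 + 1 from rfl, Nat.factorial_succ]; push_cast; ring
  have hf0 : ((n + 1).factorial : ℝ) ≠ 0 := by positivity
  have hn : ((n : ℝ) + 2) ≠ 0 := by positivity
  rw [legendreP, show n + 2 = (n + 1) + 1 from rfl, Function.iterate_succ_apply, h,
    iterate_derivative_C_mul, mul_comm (X : ℝ[X]), iterate_derivative_mul_X, legendreP,
    legendreAntideriv, ← mul_assoc, ← C_mul]
  have hc : 1 / (2 ^ (n + 1 + 1) * ((n + 1 + 1).factorial : ℝ)) * (2 * ((n : ℝ) + 1 + 1)) =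
      1 / (2 ^ (n + 1) * ((n + 1).factorial : ℝ)) := by
    rw [show n + 1 + 1 = n + 2 from rfl, hf]
    field_simp
    ring
  rw [hc]
  simp only [nsmul_eq_mul, Nat.add_sub_cancel]
  push_cast
  simp only [map_add, map_natCast, map_one]
  ring

lemma legendreP_add_two_eq_antideriv (n : ℕ) :
    legendreP (n + 2) = C (2 * (n : ℝ) + 3) * legendreAntideriv n + legendreP n := by
  have hf : ((n + 2).factorial : ℝ) = (n + 2) * ((n + 1) * n.factorial) := by
    rw [show n + 2 = n + 1 + 1 from rfl, Nat.factorial_succ, Nat.factorial_succ]; push_cast; ring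
  have hf1 : ((n + 1).factorial : ℝ) = (n + 1) * n.factorial := by
    rw [Nat.factorial_succ]; push_cast; ring
  have hf0 : (n.factorial : ℝ) ≠ 0 := by positivity
  have hn : ((n : ℝ) + 2) ≠ 0 := by positivity
  have hn1 : ((n : ℝ) + 1) ≠ 0 := by positivity
  rw [legendreP, show derivative^[n + 2] ((X ^ 2 - 1 : ℝ[X]) ^ (n + 2)) =
    derivative^[n] (derivative (derivative ((X ^ 2 - 1) ^ (n + 2)))) by
      rw [Function.iterate_add_apply]; rfl, derivative_derivative_sq_sub_one_pow,
    iterate_derivative_C_mul, iterate_map_add, iterate_derivative_C_mul,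
    iterate_derivative_C_mul, legendreP, legendreAntideriv, ← mul_assoc, ← C_mul, mul_add,
    ← mul_assoc, ← mul_assoc, ← mul_assoc, ← C_mul, ← C_mul, ← mul_assoc (C (2 * (n : ℝ) + 3)),
    ← C_mul]
  congr 3
  · rw [hf, hf1]; field_simp; ring
  · rw [hf]; field_simp; ring

/-- Bonnet's recurrence, obtained by eliminating the antiderivative from two expressions of
`P_{n+2}`. -/
lemma legendreP_recurrence (n : ℕ) :
    C ((n : ℝ) + 2) * legendreP (n + 2) =
      C (2 * (n : ℝ) + 3) * (X * legendreP (n + 1)) - C ((n : ℝ) + 1) * legendreP n := by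
  have h1 := legendreP_add_two_eq_X_mul n
  have h2 := legendreP_add_two_eq_antideriv n
  simp only [map_add, map_mul, map_natCast, map_one, map_ofNat] at h1 h2 ⊢
  linear_combination (2 * (n : ℝ[X]) + 3) * h1 - ((n : ℝ[X]) + 1) * h2

lemma derivative_legendreP_add_two (n : ℕ) :
    derivative (legendreP (n + 2)) =
      C ((n : ℝ) + 2) * legendreP (n + 1) + X * derivative (legendreP (n + 1)) := by
  rw [legendreP_add_two_eq_X_mul, derivative_add, derivative_mul, derivative_C_mul,
    derivative_legendreAntideriv, derivative_X]
  simp only [map_add, map_natCast, map_one, map_ofNat]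
  ring

lemma derivative_legendreP_add_two' (n : ℕ) :
    derivative (legendreP (n + 2)) =
      C (2 * (n : ℝ) + 3) * legendreP (n + 1) + derivative (legendreP n) := by
  rw [legendreP_add_two_eq_antideriv, derivative_add, derivative_C_mul,
    derivative_legendreAntideriv]

lemma derivative_legendreP_succ (n : ℕ) :
    derivative (legendreP (n + 1)) =
      C ((n : ℝ) + 1) * legendreP n + X * derivative (legendreP n) := by
  cases n with
  | zero => simp [legendreP_zero, legendreP_one]
  | succ n =>
    rw [derivative_legendreP_add_two]
    push_cast
    rw [show (n : ℝ) + 1 + 1 = n + 2 by ring]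

lemma derivative_legendreP_pred (n : ℕ) :
    derivative (legendreP n) =
      X * derivative (legendreP (n + 1)) - C ((n : ℝ) + 1) * legendreP (n + 1) := by
  have h1 := derivative_legendreP_add_two n
  have h2 := derivative_legendreP_add_two' n
  simp only [map_add, map_mul, map_natCast, map_one, map_ofNat] at h1 h2 ⊢
  linear_combination h1 - h2

lemma one_sub_sq_mul_derivative_legendreP (n : ℕ) :
    (1 - X ^ 2) * derivative (legendreP (n + 1)) =
      C ((n : ℝ) + 1) * (legendreP n - X * legendreP (n + 1)) := by
  linear_combination derivative_legendreP_succ n + X * derivative_legendreP_pred n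

/-- Legendre's differential equation `((1 - X²) P_l')' = -l (l + 1) P_l`. -/
lemma legendreP_ode (l : ℕ) :
    derivative ((1 - X ^ 2) * derivative (legendreP l)) =
      -(C ((l : ℝ) * ((l : ℝ) + 1)) * legendreP l) := by
  cases l with
  | zero => simp [legendreP_zero]
  | succ n =>
    rw [one_sub_sq_mul_derivative_legendreP, derivative_C_mul, derivative_sub, derivative_mul,
      derivative_X, derivative_legendreP_pred n]
    push_cast
    simp only [map_add, map_mul, map_natCast, map_one]
    ring

lemma legendreP_eval_recurrence (n : ℕ) (t : ℝ) :
    ((n : ℝ) + 2) * (legendreP (n + 2)).eval t =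
      (2 * (n : ℝ) + 3) * (t * (legendreP (n + 1)).eval t) -
        ((n : ℝ) + 1) * (legendreP n).eval t := by
  simpa using congrArg (eval t) (legendreP_recurrence n)

lemma legendreP_eval_one (l : ℕ) : (legendreP l).eval 1 = 1 := by
  induction l using Nat.twoStepInduction with
  | zero => simp [legendreP_zero]
  | one => simp [legendreP_one]
  | more n h0 h1 =>
    have h := legendreP_eval_recurrence n 1
    rw [h0, h1] at h
    have hn : ((n : ℝ) + 2) ≠ 0 := by positivity
    exact mul_left_cancel₀ hn (by linarith)

lemma legendreP_eval_neg_one (l : ℕ) : (legendreP l).eval (-1) = (-1) ^ l := by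
  induction l using Nat.twoStepInduction with
  | zero => simp [legendreP_zero]
  | one => simp [legendreP_one]
  | more n h0 h1 =>
    have h := legendreP_eval_recurrence n (-1)
    rw [h0, h1] at h
    have hn : ((n : ℝ) + 2) ≠ 0 := by positivity
    refine mul_left_cancel₀ hn (h.trans ?_)
    ring

lemma natDegree_legendreP_le (l : ℕ) : (legendreP l).natDegree ≤ l := by
  induction l using Nat.twoStepInduction with
  | zero => simp [legendreP_zero]
  | one => simp [legendreP_one]
  | more n h0 h1 =>
    have h := legendreP_recurrence n
    have hn : ((n : ℝ) + 2) ≠ 0 := by positivity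
    rw [← natDegree_C_mul hn, h]
    refine (natDegree_sub_le _ _).trans (max_le ?_ ?_)
    · refine (natDegree_C_mul_le _ _).trans (natDegree_mul_le.trans ?_)
      rw [natDegree_X]
      omega
    · exact (natDegree_C_mul_le _ _).trans (by omega)

/-- On `[-1, 1]` the polynomial `P_l` is bounded by `1`: the function
`P_l² + (1 - t²) P_l'² / (l (l + 1))` has derivative `2 t P_l'² / (l (l + 1))`, so it is largest at
`±1`, where it equals `P_l(±1)² = 1`. -/
lemma abs_legendreP_eval_le_one (l : ℕ) {t : ℝ} (ht : t ∈ Set.Icc (-1 : ℝ) 1) :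
    |(legendreP l).eval t| ≤ 1 := by
  rcases Nat.eq_zero_or_pos l with rfl | hl
  · simp [legendreP_zero]
  set lam : ℝ := l * (l + 1) with hlam
  have hl' : 0 < lam := by positivity
  set p := legendreP l with hp
  set F : ℝ[X] := p ^ 2 + C (1 / lam) * ((1 - X ^ 2) * derivative p) * derivative p with hF
  have hF' : derivative F = C (2 / lam) * (X * derivative p ^ 2) := by
    have hode := legendreP_ode l
    have h2 : (1 - X ^ 2) * derivative (derivative p) =
        2 * (X * derivative p) - C lam * p := by
      rw [derivative_mul] at hode
      simp only [derivative_sub, derivative_one, derivative_X_pow] at hode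
      simp only [Nat.cast_ofNat, map_ofNat, Nat.add_one_sub_one, pow_one] at hode
      linear_combination hode
    rw [hF, derivative_add, derivative_mul, derivative_C_mul, legendreP_ode, derivative_pow]
    have hc : C (1 / lam) * C lam = (1 : ℝ[X]) := by
      rw [← C_mul, one_div_mul_cancel hl'.ne', C_1]
    have hc2 : (C (2 / lam) : ℝ[X]) = 2 * C (1 / lam) := by
      rw [← map_ofNat (C : ℝ →+* ℝ[X]) 2, ← C_mul]; congr 1; ring
    rw [hc2, ← hlam, ← hp]
    simp only [Nat.cast_ofNat, map_ofNat, Nat.add_one_sub_one, pow_one]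
    linear_combination (C (1 / lam) * derivative p) * h2 - 2 * p * derivative p * hc
  have hend : ∀ s : ℝ, s ^ 2 = 1 → p.eval s ^ 2 = 1 → F.eval s = 1 := by
    intro s hs h1
    simp [hF, hs, h1]
  have hF1 : F.eval 1 = 1 := hend 1 (by norm_num) (by rw [hp, legendreP_eval_one]; norm_num)
  have hFm : F.eval (-1) = 1 := hend (-1) (by norm_num) (by
    rw [hp, legendreP_eval_neg_one, ← pow_mul, mul_comm, pow_mul]; norm_num)
  have hd : ∀ x, deriv (fun s => F.eval s) x = 2 / lam * (x * (derivative p).eval x ^ 2) := by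
    intro x
    rw [Polynomial.deriv, hF']
    simp
  have hFle : F.eval t ≤ 1 := by
    rcases le_total 0 t with h0 | h0
    · rw [← hF1]
      refine monotoneOn_of_deriv_nonneg (convex_Icc (0 : ℝ) 1) F.continuous.continuousOn
        F.differentiable.differentiableOn (fun x hx => ?_) ⟨h0, ht.2⟩ ⟨zero_le_one, le_rfl⟩ ht.2
      rw [interior_Icc] at hx
      rw [hd]
      have := hx.1
      positivity
    · rw [← hFm]
      refine antitoneOn_of_deriv_nonpos (convex_Icc (-1 : ℝ) 0) F.continuous.continuousOn
        F.differentiable.differentiableOn (fun x hx => ?_)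
        ⟨le_rfl, by norm_num⟩ ⟨ht.1, h0⟩ ht.1
      rw [interior_Icc] at hx
      rw [hd]
      exact mul_nonpos_of_nonneg_of_nonpos (by positivity)
        (mul_nonpos_of_nonpos_of_nonneg hx.2.le (sq_nonneg _))
  have hFp : p.eval t ^ 2 ≤ F.eval t := by
    have : 0 ≤ 1 - t ^ 2 := by nlinarith [ht.1, ht.2]
    have h : F.eval t = p.eval t ^ 2 + 1 / lam * (1 - t ^ 2) * (derivative p).eval t ^ 2 := by
      simp [hF]; ring
    rw [h]
    have : 0 ≤ 1 / lam * (1 - t ^ 2) * (derivative p).eval t ^ 2 := by positivity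
    linarith
  exact (sq_le_one_iff_abs_le_one _).1 (hFp.trans hFle)

lemma integral_derivative_eval (p : ℝ[X]) (a b : ℝ) :
    ∫ t in a..b, (derivative p).eval t = p.eval b - p.eval a :=
  intervalIntegral.integral_eq_sub_of_hasDerivAt (fun t _ => p.hasDerivAt t)
    ((derivative p).continuous.intervalIntegrable _ _)

/-- Orthogonality of the Legendre polynomials, by the Wronskian identity for Legendre's equation. -/
lemma integral_legendreP_mul_of_ne {k l : ℕ} (h : k ≠ l) :
    ∫ t in (-1 : ℝ)..1, (legendreP k * legendreP l).eval t = 0 := by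
  set lam : ℕ → ℝ := fun n => (n : ℝ) * (n + 1) with hlam
  have hne : lam k - lam l ≠ 0 := by
    have h1 : lam k - lam l = ((k : ℝ) - l) * (k + l + 1) := by simp only [hlam]; ring
    rw [h1]
    exact mul_ne_zero (sub_ne_zero.2 (by exact_mod_cast h)) (by positivity)
  have hW : derivative (legendreP k * ((1 - X ^ 2) * derivative (legendreP l)) -
      legendreP l * ((1 - X ^ 2) * derivative (legendreP k))) =
      C (lam k - lam l) * (legendreP k * legendreP l) := by
    rw [derivative_sub, derivative_mul, derivative_mul (f := legendreP l), legendreP_ode,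
      legendreP_ode, map_sub]
    ring
  have hI := integral_derivative_eval (legendreP k * ((1 - X ^ 2) * derivative (legendreP l)) -
      legendreP l * ((1 - X ^ 2) * derivative (legendreP k))) (-1) 1
  rw [hW] at hI
  simp only [eval_mul, eval_C, eval_sub, eval_one, eval_pow, eval_X] at hI
  rw [intervalIntegral.integral_const_mul] at hI
  norm_num at hI
  simpa using hI.resolve_left hne

lemma intervalIntegrable_eval (p : ℝ[X]) (a b : ℝ) :
    IntervalIntegrable (fun t => p.eval t) volume a b :=
  p.continuous.intervalIntegrable a b

lemma integral_legendreP_sq (l : ℕ) :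
    ∫ t in (-1 : ℝ)..1, (legendreP l * legendreP l).eval t = 2 / (2 * (l : ℝ) + 1) := by
  induction l with
  | zero => simp [legendreP_zero]; norm_num
  | succ n ih =>
    -- `∫ t P_n P_{n+1}` is expressed through each of the two norms by Bonnet's recurrence
    set J := ∫ t in (-1 : ℝ)..1, (X * legendreP n * legendreP (n + 1)).eval t with hJ
    have hlow : ((n : ℝ) + 1) * ∫ t in (-1 : ℝ)..1, (legendreP (n + 1) * legendreP (n + 1)).eval t =
        (2 * (n : ℝ) + 1) * J := by
      rw [hJ]
      cases n with
      | zero => simp [legendreP_zero, legendreP_one]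
      | succ m =>
        have h0 := integral_legendreP_mul_of_ne (k := m) (l := m + 2) (by omega)
        rw [← intervalIntegral.integral_const_mul, ← intervalIntegral.integral_const_mul]
        have e : ∀ t : ℝ, (((m + 1 : ℕ) : ℝ) + 1) *
            (legendreP (m + 1 + 1) * legendreP (m + 1 + 1)).eval t =
            (2 * ((m + 1 : ℕ) : ℝ) + 1) *
              (X * legendreP (m + 1) * legendreP (m + 1 + 1)).eval t -
            ((m : ℝ) + 1) * (legendreP m * legendreP (m + 2)).eval t := by
          intro t
          have := legendreP_eval_recurrence m t
          simp only [eval_mul, eval_X]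
          push_cast
          linear_combination (legendreP (m + 2)).eval t * this
        simp_rw [e]
        rw [intervalIntegral.integral_sub ((intervalIntegrable_eval _ _ _).const_mul _)
          ((intervalIntegrable_eval _ _ _).const_mul _),
          intervalIntegral.integral_const_mul ((m : ℝ) + 1), h0]
        simp
    have hhigh : (2 * (n : ℝ) + 3) * J =
        ((n : ℝ) + 1) * ∫ t in (-1 : ℝ)..1, (legendreP n * legendreP n).eval t := by
      have h0 := integral_legendreP_mul_of_ne (k := n + 2) (l := n) (by omega)
      rw [hJ, ← intervalIntegral.integral_const_mul, ← intervalIntegral.integral_const_mul]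
      have e : ∀ t : ℝ, (2 * (n : ℝ) + 3) * (X * legendreP n * legendreP (n + 1)).eval t =
          ((n : ℝ) + 1) * (legendreP n * legendreP n).eval t +
            ((n : ℝ) + 2) * (legendreP (n + 2) * legendreP n).eval t := by
        intro t
        have := legendreP_eval_recurrence n t
        simp only [eval_mul, eval_X]
        linear_combination -(legendreP n).eval t * this
      simp_rw [e]
      rw [intervalIntegral.integral_add ((intervalIntegrable_eval _ _ _).const_mul _)
        ((intervalIntegrable_eval _ _ _).const_mul _),
        intervalIntegral.integral_const_mul ((n : ℝ) + 2), h0]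
      simp
    rw [ih] at hhigh
    have hn1 : ((n : ℝ) + 1) ≠ 0 := by positivity
    have hn2 : (2 * (n : ℝ) + 3) ≠ 0 := by positivity
    have hn3 : (2 * (n : ℝ) + 1) ≠ 0 := by positivity
    refine mul_left_cancel₀ hn1 (hlow.trans ?_)
    have : J = ((n : ℝ) + 1) * (2 / (2 * n + 1)) / (2 * n + 3) := by
      rw [← hhigh]; field_simp
    rw [this]
    push_cast
    rw [show 2 * ((n : ℝ) + 1) + 1 = 2 * n + 3 by ring]
    field_simp

/-- A polynomial of degree at most `n` is a combination of `P_0, …, P_n`. -/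
lemma mem_span_legendreP {n : ℕ} {p : ℝ[X]} (hp : p.natDegree ≤ n) :
    p ∈ Submodule.span ℝ (legendreP '' Set.Iic n) := by
  have hX : ∀ k, (X ^ k : ℝ[X]) ∈ Submodule.span ℝ (legendreP '' Set.Iic k) := by
    intro k
    induction k with
    | zero =>
      exact Submodule.subset_span ⟨0, Set.self_mem_Iic, by simp [legendreP_zero]⟩
    | succ k ih =>
      rw [pow_succ']
      have hle : Submodule.span ℝ (legendreP '' Set.Iic k) ≤
          (Submodule.span ℝ (legendreP '' Set.Iic (k + 1))).comap
            (LinearMap.mulLeft ℝ (X : ℝ[X])) := by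
        rw [Submodule.span_le]
        rintro _ ⟨j, hj, rfl⟩
        have hj' : j ≤ k := hj
        simp only [Submodule.comap_coe, Set.mem_preimage, LinearMap.mulLeft_apply, SetLike.mem_coe]
        cases j with
        | zero =>
          rw [legendreP_zero, mul_one, ← legendreP_one]
          exact Submodule.subset_span ⟨1, by simp, rfl⟩
        | succ m =>
          have h3 : (2 * (m : ℝ) + 3) ≠ 0 := by positivity
          have e : X * legendreP (m + 1) =
              (((m : ℝ) + 2) / (2 * m + 3)) • legendreP (m + 2) +
                (((m : ℝ) + 1) / (2 * m + 3)) • legendreP m := by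
            refine Polynomial.funext fun t => ?_
            have := legendreP_eval_recurrence m t
            simp only [eval_mul, eval_X, eval_add, eval_smul, smul_eq_mul]
            field_simp
            linear_combination -this
          rw [e]
          refine add_mem (Submodule.smul_mem _ _ (Submodule.subset_span ⟨m + 2, ?_, rfl⟩))
            (Submodule.smul_mem _ _ (Submodule.subset_span ⟨m, ?_, rfl⟩))
          · simp only [Set.mem_Iic]; omega
          · simp only [Set.mem_Iic]; omega
      exact hle ih
  rw [p.as_sum_range_C_mul_X_pow]
  refine Submodule.sum_mem _ fun i hi => ?_
  rw [← smul_eq_C_mul]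
  refine Submodule.smul_mem _ _ (Submodule.span_mono (Set.image_mono ?_) (hX i))
  rw [Finset.mem_range] at hi
  exact Set.Iic_subset_Iic.2 (by omega)

lemma integral_legendreP_mul_of_natDegree_lt {k : ℕ} {q : ℝ[X]} (hq : q.natDegree < k) :
    ∫ t in (-1 : ℝ)..1, (legendreP k * q).eval t = 0 := by
  have hk : 0 < k := by omega
  have h := mem_span_legendreP (p := q) (n := k - 1) (by omega)
  clear hq
  induction h using Submodule.span_induction with
  | mem x hx =>
    obtain ⟨j, hj, rfl⟩ := hx
    have hj' : j ≤ k - 1 := hj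
    exact integral_legendreP_mul_of_ne (by omega)
  | zero => simp
  | add x y _ _ hx hy =>
    simp only [mul_add, eval_add]
    rw [intervalIntegral.integral_add (intervalIntegrable_eval _ _ _)
      (intervalIntegrable_eval _ _ _), hx, hy, add_zero]
  | smul a x _ hx =>
    simp only [mul_smul_comm, eval_smul, smul_eq_mul]
    rw [intervalIntegral.integral_const_mul, hx, mul_zero]

end Legendre

/-! ### Spherical coordinates -/

section SphericalCoordinates

open scoped ENNReal

/-- The point of the unit sphere with colatitude `θ` and longitude `φ` relative to the orthonormal
basis `b`, whose first vector points to the north pole. -/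
noncomputable def frameSpherePoint (b : OrthonormalBasis (Fin 3) ℝ E3) (θ φ : ℝ) : E3 :=
  Real.cos θ • b 0 + (Real.sin θ * Real.cos φ) • b 1 + (Real.sin θ * Real.sin φ) • b 2

lemma continuous_frameSpherePoint (b : OrthonormalBasis (Fin 3) ℝ E3) :
    Continuous fun p : ℝ × ℝ => frameSpherePoint b p.1 p.2 := by
  unfold frameSpherePoint
  fun_prop

lemma norm_frame_combination (b : OrthonormalBasis (Fin 3) ℝ E3) (x y z : ℝ) :
    ‖x • b 0 + y • b 1 + z • b 2‖ = √(x ^ 2 + y ^ 2 + z ^ 2) := by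
  have h : x • b 0 + y • b 1 + z • b 2 = b.repr.symm !₂[x, y, z] := by
    rw [← b.sum_repr_symm, Fin.sum_univ_three]
    simp
  rw [h, LinearIsometryEquiv.norm_map, EuclideanSpace.norm_eq, Fin.sum_univ_three]
  simp

lemma norm_smul_frameSpherePoint (b : OrthonormalBasis (Fin 3) ℝ E3) {r : ℝ} (hr : 0 < r)
    (θ φ : ℝ) : ‖r • frameSpherePoint b θ φ‖ = r := by
  rw [norm_smul, frameSpherePoint, norm_frame_combination]
  have : Real.cos θ ^ 2 + (Real.sin θ * Real.cos φ) ^ 2 + (Real.sin θ * Real.sin φ) ^ 2 = 1 := by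
    linear_combination Real.sin θ ^ 2 * Real.sin_sq_add_cos_sq φ + Real.sin_sq_add_cos_sq θ
  rw [this, Real.sqrt_one, mul_one, Real.norm_of_nonneg hr.le]

lemma lintegral_volume_eq_frame (b : OrthonormalBasis (Fin 3) ℝ E3) {Φ : E3 → ℝ≥0∞}
    (hΦ : Measurable Φ) :
    ∫⁻ x, Φ x = ∫⁻ a : ℝ, ∫⁻ p : ℝ × ℝ, Φ (a • b 0 + p.1 • b 1 + p.2 • b 2) := by
  have h1 := (b.measurePreserving_repr_symm.comp (PiLp.volume_preserving_toLp (Fin 3)))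
  have h2 := h1.comp ((volume_preserving_piFinSuccAbove (fun _ : Fin 3 => ℝ) 0).symm
    (MeasurableEquiv.piFinSuccAbove (fun _ : Fin 3 => ℝ) 0))
  have h3 := h2.comp ((MeasurePreserving.id (volume : Measure ℝ)).prod
    ((volume_preserving_finTwoArrow ℝ).symm MeasurableEquiv.finTwoArrow))
  rw [← h3.lintegral_comp hΦ]
  refine (lintegral_prod _ (hΦ.comp h3.measurable).aemeasurable).trans ?_
  refine lintegral_congr fun a => lintegral_congr fun p => ?_
  refine congrArg Φ ?_
  refine Eq.trans ?_ (Fin.sum_univ_three fun i => (![a, p.1, p.2] : Fin 3 → ℝ) i • b i)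
  have hv : (MeasurableEquiv.piFinSuccAbove (fun _ : Fin 3 => ℝ) 0).symm
      (a, MeasurableEquiv.finTwoArrow.symm p) = ![a, p.1, p.2] := by
    ext i
    fin_cases i <;> rfl
  refine Eq.trans ?_ (b.sum_repr_symm (WithLp.toLp 2 ![a, p.1, p.2])).symm
  rw [← hv]
  rfl

/-- The indicator of the unit ball serves as a radial weight that relates integrals over space to
integrals over the sphere. -/
lemma lintegral_toSphere_mul_radial {F : E3 → ℝ≥0∞} (hF : Measurable F) :
    ∫⁻ x : E3, F (‖x‖⁻¹ • x) * (Set.Iio (1 : ℝ)).indicator 1 ‖x‖ =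
      (∫⁻ ξ : Sph 1, F ξ ∂(volume : Measure E3).toSphere) *
        ∫⁻ r in Set.Ioi (0 : ℝ), ENNReal.ofReal (r ^ 2) * (Set.Iio (1 : ℝ)).indicator 1 r := by
  have hχ : Measurable ((Set.Iio (1 : ℝ)).indicator (1 : ℝ → ℝ≥0∞)) :=
    measurable_one.indicator measurableSet_Iio
  have hmp := (volume : Measure E3).measurePreserving_homeomorphUnitSphereProd
  have hd : Module.finrank ℝ E3 - 1 = 2 := by simp
  rw [hd] at hmp
  have h1 : Measurable fun q : Sph 1 × Set.Ioi (0 : ℝ) =>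
      F q.1 * (Set.Iio (1 : ℝ)).indicator (1 : ℝ → ℝ≥0∞) q.2 :=
    (hF.comp (measurable_subtype_coe.comp measurable_fst)).mul
      (hχ.comp (measurable_subtype_coe.comp measurable_snd))
  calc _ = ∫⁻ x : ({(0)}ᶜ : Set E3), F (‖(x : E3)‖⁻¹ • (x : E3)) *
        (Set.Iio (1 : ℝ)).indicator 1 ‖(x : E3)‖ ∂((volume : Measure E3).comap (↑)) := by
        rw [lintegral_subtype_comap (measurableSet_singleton _).compl
          fun x : E3 => F (‖x‖⁻¹ • x) * (Set.Iio (1 : ℝ)).indicator (1 : ℝ → ℝ≥0∞) ‖x‖,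
          restrict_compl_singleton]
    _ = ∫⁻ q : Sph 1 × Set.Ioi (0 : ℝ), F q.1 * (Set.Iio (1 : ℝ)).indicator (1 : ℝ → ℝ≥0∞) q.2
          ∂(volume : Measure E3).toSphere.prod (.volumeIoiPow 2) := by
        rw [← hmp.lintegral_comp h1]
        refine lintegral_congr fun x => ?_
        simp
    _ = _ := by
        rw [lintegral_prod_mul (f := fun ξ : Sph 1 => F ξ)
          (g := fun r : Set.Ioi (0 : ℝ) => (Set.Iio (1 : ℝ)).indicator (1 : ℝ → ℝ≥0∞) r)
          (hF.comp measurable_subtype_coe).aemeasurable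
          (hχ.comp measurable_subtype_coe).aemeasurable]
        congr 1
        rw [Measure.volumeIoiPow, lintegral_withDensity_eq_lintegral_mul _
          (by fun_prop)
          (g := fun r : Set.Ioi (0 : ℝ) => (Set.Iio (1 : ℝ)).indicator (1 : ℝ → ℝ≥0∞) r)
          (hχ.comp measurable_subtype_coe)]
        exact lintegral_subtype_comap measurableSet_Ioi
          fun r : ℝ => ENNReal.ofReal (r ^ 2) * (Set.Iio (1 : ℝ)).indicator (1 : ℝ → ℝ≥0∞) r

/-- Spherical coordinates in space, from planar polar coordinates applied twice. -/
lemma lintegral_frame_spherical (b : OrthonormalBasis (Fin 3) ℝ E3) {Φ : E3 → ℝ≥0∞}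
    (hΦ : Measurable Φ) :
    ∫⁻ x, Φ x = ∫⁻ r in Set.Ioi (0 : ℝ), ∫⁻ θ in Set.Ioo 0 Real.pi,
      ENNReal.ofReal r * ∫⁻ φ in Set.Ioo (-Real.pi) Real.pi,
        ENNReal.ofReal (r * Real.sin θ) * Φ (r • frameSpherePoint b θ φ) := by
  set J : ℝ × ℝ → ℝ≥0∞ := fun q => ∫⁻ φ in Set.Ioo (-Real.pi) Real.pi,
    ENNReal.ofReal q.2 * Φ (q.1 • b 0 + (q.2 * Real.cos φ) • b 1 + (q.2 * Real.sin φ) • b 2)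
    with hJdef
  have hJ0 : Measurable fun z : (ℝ × ℝ) × ℝ => ENNReal.ofReal z.1.2 *
      Φ (z.1.1 • b 0 + (z.1.2 * Real.cos z.2) • b 1 + (z.1.2 * Real.sin z.2) • b 2) :=
    (by fun_prop : Measurable fun z : (ℝ × ℝ) × ℝ => ENNReal.ofReal z.1.2).mul
      (hΦ.comp (by fun_prop))
  have hJ : Measurable J := hJ0.lintegral_prod_right'
  have hind : Measurable fun q : ℝ × ℝ => (Set.Ioi (0 : ℝ)).indicator (fun _ => J q) q.2 := by
    have : (fun q : ℝ × ℝ => (Set.Ioi (0 : ℝ)).indicator (fun _ => J q) q.2) =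
        (Prod.snd ⁻¹' Set.Ioi (0 : ℝ)).indicator J := by
      ext q; simp [Set.indicator]
    rw [this]
    exact hJ.indicator (measurable_snd measurableSet_Ioi)
  have htarget : (volume : Measure (ℝ × ℝ)).restrict polarCoord.target =
      (volume.restrict (Set.Ioi (0 : ℝ))).prod
        (volume.restrict (Set.Ioo (-Real.pi) Real.pi)) := by
    rw [polarCoord_target, Measure.volume_eq_prod, Measure.prod_restrict]
  rw [lintegral_volume_eq_frame b hΦ]
  -- polar coordinates in the equatorial plane
  have step1 : ∀ a : ℝ, ∫⁻ p : ℝ × ℝ, Φ (a • b 0 + p.1 • b 1 + p.2 • b 2) =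
      ∫⁻ ρ, (Set.Ioi (0 : ℝ)).indicator (fun _ => J (a, ρ)) ρ := by
    intro a
    rw [← lintegral_comp_polarCoord_symm, htarget]
    refine (lintegral_prod _ ?_).trans ?_
    · exact (hJ0.comp (by fun_prop : Measurable fun p : ℝ × ℝ => ((a, p.1), p.2))).aemeasurable
    · rw [← lintegral_indicator measurableSet_Ioi]
      rfl
  simp_rw [step1]
  have step2 := lintegral_prod (μ := (volume : Measure ℝ)) (ν := (volume : Measure ℝ))
    (fun q : ℝ × ℝ => (Set.Ioi (0 : ℝ)).indicator (fun _ => J q) q.2) hind.aemeasurable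
  rw [← Measure.volume_eq_prod] at step2
  -- polar coordinates in the meridional half-plane
  rw [← step2, ← lintegral_comp_polarCoord_symm, htarget]
  refine (lintegral_prod _ ?_).trans ?_
  · exact ((by fun_prop : Measurable fun p : ℝ × ℝ => ENNReal.ofReal p.1).mul
      (hind.comp continuous_polarCoord_symm.measurable)).aemeasurable
  refine setLIntegral_congr_fun measurableSet_Ioi fun r hr => ?_
  have hr' : (0 : ℝ) < r := hr
  have hsub : Set.Ioo 0 Real.pi ⊆ Set.Ioo (-Real.pi) Real.pi :=
    Set.Ioo_subset_Ioo_left (by linarith [Real.pi_pos])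
  rw [← lintegral_indicator measurableSet_Ioo, ← lintegral_indicator measurableSet_Ioo]
  refine lintegral_congr fun θ => ?_
  simp only [polarCoord_symm_apply, smul_eq_mul]
  by_cases h1 : θ ∈ Set.Ioo 0 Real.pi
  · have hs : 0 < r * Real.sin θ := mul_pos hr' (Real.sin_pos_of_mem_Ioo h1)
    rw [Set.indicator_of_mem h1, Set.indicator_of_mem (hsub h1),
      Set.indicator_of_mem (show r * Real.sin θ ∈ Set.Ioi (0 : ℝ) from hs)]
    simp only [hJdef, frameSpherePoint, smul_add, smul_smul, mul_assoc]
  · rw [Set.indicator_of_notMem h1]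
    by_cases h2 : θ ∈ Set.Ioo (-Real.pi) Real.pi
    · have h3 : θ ≤ 0 := by
        by_contra h
        exact h1 ⟨not_le.1 h, h2.2⟩
      have hs : ¬ (0 < r * Real.sin θ) := not_lt.2
        (mul_nonpos_of_nonneg_of_nonpos hr'.le
          (Real.sin_nonpos_of_nonpos_of_neg_pi_le h3 h2.1.le))
      rw [Set.indicator_of_mem h2,
        Set.indicator_of_notMem (show r * Real.sin θ ∉ Set.Ioi (0 : ℝ) from hs), mul_zero]
    · rw [Set.indicator_of_notMem h2]

/-- Integration over the unit sphere in spherical coordinates relative to any orthonormal basis. -/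
theorem lintegral_toSphere_eq_spherical (b : OrthonormalBasis (Fin 3) ℝ E3) {F : E3 → ℝ≥0∞}
    (hF : Measurable F) :
    ∫⁻ ξ : Sph 1, F ξ ∂(volume : Measure E3).toSphere =
      ∫⁻ θ in Set.Ioo 0 Real.pi, ENNReal.ofReal (Real.sin θ) *
        ∫⁻ φ in Set.Ioo (-Real.pi) Real.pi, F (frameSpherePoint b θ φ) := by
  set K := ∫⁻ r in Set.Ioi (0 : ℝ), ENNReal.ofReal (r ^ 2) * (Set.Iio (1 : ℝ)).indicator 1 r
    with hK
  have hχ : Measurable ((Set.Iio (1 : ℝ)).indicator (1 : ℝ → ℝ≥0∞)) :=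
    measurable_one.indicator measurableSet_Iio
  have hw : Measurable fun r : ℝ =>
      ENNReal.ofReal (r ^ 2) * (Set.Iio (1 : ℝ)).indicator (1 : ℝ → ℝ≥0∞) r :=
    (by fun_prop : Measurable fun r : ℝ => ENNReal.ofReal (r ^ 2)).mul hχ
  have hKval : K = ENNReal.ofReal (1 / 3) := by
    have h := Measure.volumeIoiPow_apply_Iio 2 ⟨1, Set.mem_Ioi.2 one_pos⟩
    rw [Measure.volumeIoiPow, withDensity_apply _ measurableSet_Iio,
      setLIntegral_subtype measurableSet_Ioi _ fun a : ℝ => ENNReal.ofReal (a ^ 2),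
      Set.image_subtype_val_Ioi_Iio] at h
    rw [hK, show (1 / 3 : ℝ) = 1 ^ (2 + 1) / ((2 : ℕ) + 1) by norm_num, ← h,
      ← lintegral_indicator measurableSet_Ioi, ← lintegral_indicator measurableSet_Ioo]
    refine lintegral_congr fun r => ?_
    by_cases h1 : 0 < r <;> by_cases h2 : r < 1 <;> simp [Set.indicator, h1, h2]
  have hK0 : K ≠ 0 := by rw [hKval]; simp
  have hKt : K ≠ ⊤ := by rw [hKval]; simp
  rw [← ENNReal.mul_left_inj hK0 hKt, ← lintegral_toSphere_mul_radial hF,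
    lintegral_frame_spherical b
      (Φ := fun x => F (‖x‖⁻¹ • x) * (Set.Iio (1 : ℝ)).indicator 1 ‖x‖)
      ((hF.comp (by fun_prop)).mul (hχ.comp measurable_norm)), mul_comm, hK,
    ← lintegral_mul_const _ hw]
  · refine setLIntegral_congr_fun measurableSet_Ioi fun r hr => ?_
    have hr' : (0 : ℝ) < r := hr
    rw [← lintegral_const_mul' _ _ ?_]
    · refine setLIntegral_congr_fun measurableSet_Ioo fun θ hθ => ?_
      have hs := Real.sin_pos_of_mem_Ioo hθ
      have e : ∀ φ, ENNReal.ofReal (r * Real.sin θ) *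
          (F (‖r • frameSpherePoint b θ φ‖⁻¹ • r • frameSpherePoint b θ φ) *
            (Set.Iio (1 : ℝ)).indicator 1 ‖r • frameSpherePoint b θ φ‖) =
          (ENNReal.ofReal (r * Real.sin θ) * (Set.Iio (1 : ℝ)).indicator 1 r) *
            F (frameSpherePoint b θ φ) := by
        intro φ
        rw [norm_smul_frameSpherePoint b hr', smul_smul, inv_mul_cancel₀ hr'.ne', one_smul]
        ring
      simp only [e]
      rw [lintegral_const_mul' _ _ ?_, ENNReal.ofReal_mul hr'.le, sq, ENNReal.ofReal_mul hr'.le]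
      · ring
      · refine ENNReal.mul_ne_top ENNReal.ofReal_ne_top ?_
        by_cases h2 : r < 1 <;> simp [Set.indicator, h2]
    · refine ENNReal.mul_ne_top ENNReal.ofReal_ne_top ?_
      by_cases h2 : r < 1 <;> simp [Set.indicator, h2]
end SphericalCoordinates

/-! ### Averages over circles of latitude -/

section SphereAverages

open scoped ENNReal

lemma exists_orthonormalBasis_first {e : E3} (he : ‖e‖ = 1) :
    ∃ b : OrthonormalBasis (Fin 3) ℝ E3, b 0 = e := by
  have hon : Orthonormal ℝ (({0} : Set (Fin 3)).domRestrict fun _ => e) := by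
    refine ⟨fun _ => he, fun i j hij => ?_⟩
    exact absurd (Subsingleton.elim i j) hij
  obtain ⟨b, hb⟩ := hon.exists_orthonormalBasis_extension_of_card_eq (by simp)
  exact ⟨b, hb 0 rfl⟩

lemma map_coe_toSphere_eq_spherical (b : OrthonormalBasis (Fin 3) ℝ E3) :
    (volume : Measure E3).toSphere.map ((↑) : Sph 1 → E3) =
      ((((volume : Measure ℝ).restrict (Set.Ioo 0 Real.pi)).withDensity
        fun θ => ENNReal.ofReal (Real.sin θ)).prod
          ((volume : Measure ℝ).restrict (Set.Ioo (-Real.pi) Real.pi))).map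
        fun p => frameSpherePoint b p.1 p.2 := by
  refine Measure.ext_of_lintegral _ fun F hF => ?_
  have hm : Measurable fun p : ℝ × ℝ => frameSpherePoint b p.1 p.2 :=
    (continuous_frameSpherePoint b).measurable
  rw [lintegral_map hF measurable_subtype_coe, lintegral_toSphere_eq_spherical b hF,
    lintegral_map hF hm,
    lintegral_prod (fun p : ℝ × ℝ => F (frameSpherePoint b p.1 p.2)) (hF.comp hm).aemeasurable,
    lintegral_withDensity_eq_lintegral_mul _ (by fun_prop)
      (g := fun θ => ∫⁻ φ in Set.Ioo (-Real.pi) Real.pi, F (frameSpherePoint b θ φ))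
      (hF.comp hm).lintegral_prod_right']
  rfl

lemma integral_toSphere_eq_spherical (b : OrthonormalBasis (Fin 3) ℝ E3) {f : E3 → ℝ}
    (hf : Continuous f) :
    ∫ ξ : Sph 1, f ξ ∂(volume : Measure E3).toSphere =
      ∫ θ in (0 : ℝ)..Real.pi, Real.sin θ *
        ∫ φ in (-Real.pi)..Real.pi, f (frameSpherePoint b θ φ) := by
  have hm : Measurable fun p : ℝ × ℝ => frameSpherePoint b p.1 p.2 :=
    (continuous_frameSpherePoint b).measurable
  have hint : Integrable f ((volume : Measure E3).toSphere.map ((↑) : Sph 1 → E3)) := by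
    rw [(MeasurableEmbedding.subtype_coe isClosed_sphere.measurableSet).integrable_map_iff]
    exact (hf.comp continuous_subtype_val).integrable_of_hasCompactSupport
      (HasCompactSupport.of_compactSpace _)
  have h1 : ∫ ξ : Sph 1, f ξ ∂(volume : Measure E3).toSphere =
      ∫ x, f x ∂((volume : Measure E3).toSphere.map ((↑) : Sph 1 → E3)) :=
    (integral_map measurable_subtype_coe.aemeasurable hf.aestronglyMeasurable).symm
  rw [map_coe_toSphere_eq_spherical b] at h1 hint
  rw [h1, integral_map hm.aemeasurable hf.aestronglyMeasurable,
    integral_prod (fun p : ℝ × ℝ => f (frameSpherePoint b p.1 p.2)) (hint.comp_measurable hm),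
    integral_withDensity_eq_integral_toReal_smul (by fun_prop)
      (Eventually.of_forall fun _ => ENNReal.ofReal_lt_top),
    intervalIntegral.integral_of_le Real.pi_pos.le, integral_Ioc_eq_integral_Ioo]
  refine setIntegral_congr_fun measurableSet_Ioo fun θ hθ => ?_
  simp only [smul_eq_mul]
  rw [ENNReal.toReal_ofReal (Real.sin_pos_of_mem_Ioo hθ).le,
    intervalIntegral.integral_of_le (by linarith [Real.pi_pos]), integral_Ioc_eq_integral_Ioo]

instance nullSingletonClass_toSphere : NullSingletonClass (volume : Measure E3).toSphere := by
  refine ⟨fun x => ?_⟩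
  obtain ⟨b, hb⟩ := exists_orthonormalBasis_first (mem_sphere_zero_iff_norm.1 x.2)
  have h := lintegral_toSphere_eq_spherical b
    (F := ({(x : E3)} : Set E3).indicator 1) (measurable_one.indicator (measurableSet_singleton _))
  have hl : ∫⁻ ξ : Sph 1, ({(x : E3)} : Set E3).indicator 1 (ξ : E3)
      ∂(volume : Measure E3).toSphere = (volume : Measure E3).toSphere {x} := by
    rw [← lintegral_indicator_one (measurableSet_singleton x)]
    refine lintegral_congr fun ξ => ?_
    by_cases hξ : ξ = x
    · simp [hξ]
    · simp [hξ, Subtype.val_injective.eq_iff]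
  rw [← hl, h]
  refine (setLIntegral_congr_fun (g := fun _ => 0) measurableSet_Ioo fun θ hθ => ?_).trans
    (by simp)
  have hne : ∀ φ, frameSpherePoint b θ φ ∉ ({(x : E3)} : Set E3) := by
    intro φ hφ
    have h1 : inner ℝ (b 0) (frameSpherePoint b θ φ) = Real.cos θ := by
      simp [frameSpherePoint, inner_add_right, inner_smul_right]
    rw [Set.mem_singleton_iff.1 hφ, ← hb, real_inner_self_eq_norm_sq, b.norm_eq_one] at h1
    have := Real.cos_lt_cos_of_nonneg_of_le_pi le_rfl hθ.2.le hθ.1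
    rw [Real.cos_zero] at this
    linarith
  simp [Set.indicator_of_notMem (hne _)]

lemma integral_trig_pow_odd (α β : ℝ) {j : ℕ} (hj : Odd j) :
    ∫ φ in (-Real.pi)..Real.pi, (α * Real.cos φ + β * Real.sin φ) ^ j = 0 := by
  set g : ℝ → ℝ := fun φ => (α * Real.cos φ + β * Real.sin φ) ^ j with hg
  have hper : Function.Periodic g (2 * Real.pi) := by
    intro φ
    simp [hg]
  have hneg : ∀ φ, g (φ + Real.pi) = -g φ := by
    intro φ
    simp only [hg, Real.cos_add_pi, Real.sin_add_pi]
    rw [← hj.neg_pow]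
    congr 1
    ring
  have h1 := hper.intervalIntegral_add_eq (-Real.pi) 0
  have h2 : ∫ φ in (-Real.pi)..Real.pi, g (φ + Real.pi) =
      ∫ φ in (0 : ℝ)..(0 + 2 * Real.pi), g φ := by
    rw [intervalIntegral.integral_comp_add_right]
    congr 1 <;> ring
  simp_rw [hneg, intervalIntegral.integral_neg] at h2
  rw [show -Real.pi + 2 * Real.pi = Real.pi by ring] at h1
  rw [← h1] at h2
  linarith

open Polynomial in
/-- The average of `⟪z, ·⟫ ^ n` over the circles of latitude about `b 0` is a polynomial of degree
at most `n` in the cosine of the colatitude: odd powers of `sin θ` come with vanishing moments. -/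
lemma exists_average_pow (b : OrthonormalBasis (Fin 3) ℝ E3) (z : E3) (n : ℕ) :
    ∃ Q : ℝ[X], Q.natDegree ≤ n ∧ Q.eval 1 = inner ℝ z (b 0) ^ n ∧
      ∀ θ, ∫ φ in (-Real.pi)..Real.pi, inner ℝ z (frameSpherePoint b θ φ) ^ n =
        2 * Real.pi * Q.eval (Real.cos θ) := by
  set M : ℕ → ℝ := fun j => ∫ φ in (-Real.pi)..Real.pi,
    (inner ℝ z (b 1) * Real.cos φ + inner ℝ z (b 2) * Real.sin φ) ^ j with hM
  have hModd : ∀ j, Odd j → M j = 0 := fun j hj => integral_trig_pow_odd _ _ hj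
  have hM0 : M 0 = 2 * Real.pi := by simp [hM]; ring
  have hpi : (2 * Real.pi) ≠ 0 := by positivity
  refine ⟨∑ m ∈ Finset.range (n + 1), C (inner ℝ z (b 0) ^ m * (M (n - m) / (2 * Real.pi)) *
    (n.choose m : ℝ)) * (X ^ m * (1 - X ^ 2) ^ ((n - m) / 2)), ?_, ?_, ?_⟩
  · refine natDegree_sum_le_of_forall_le _ _ fun m hm => ?_
    rw [Finset.mem_range] at hm
    refine (natDegree_C_mul_le _ _).trans (natDegree_mul_le.trans ?_)
    have h2 : (1 - X ^ 2 : ℝ[X]).natDegree ≤ 2 := by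
      refine (natDegree_sub_le _ _).trans (max_le (by simp) (by simp))
    have h3 := natDegree_pow_le_of_le ((n - m) / 2) h2
    rw [natDegree_X_pow]
    omega
  · rw [eval_finsetSum, Finset.sum_eq_single_of_mem n (by simp)]
    · simp [hM0, hpi]
    · intro m hm hmn
      rw [Finset.mem_range] at hm
      rcases Nat.even_or_odd (n - m) with he | ho
      · have : (n - m) / 2 ≠ 0 := by
          obtain ⟨i, hi⟩ := he
          omega
        simp [this]
      · simp [hModd _ ho]
  · intro θ
    have e : ∀ φ, inner ℝ z (frameSpherePoint b θ φ) ^ n =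
        ∑ m ∈ Finset.range (n + 1), (inner ℝ z (b 0) * Real.cos θ) ^ m * Real.sin θ ^ (n - m) *
          (n.choose m : ℝ) *
            (inner ℝ z (b 1) * Real.cos φ + inner ℝ z (b 2) * Real.sin φ) ^ (n - m) := by
      intro φ
      have : inner ℝ z (frameSpherePoint b θ φ) = inner ℝ z (b 0) * Real.cos θ + Real.sin θ *
          (inner ℝ z (b 1) * Real.cos φ + inner ℝ z (b 2) * Real.sin φ) := by
        simp only [frameSpherePoint, inner_add_right, inner_smul_right]
        ring
      rw [this, add_pow]
      refine Finset.sum_congr rfl fun m _ => ?_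
      rw [mul_pow (Real.sin θ)]
      ring
    simp_rw [e]
    rw [intervalIntegral.integral_finsetSum fun m _ =>
      Continuous.intervalIntegrable (by fun_prop) _ _, eval_finsetSum, Finset.mul_sum]
    refine Finset.sum_congr rfl fun m _ => ?_
    rw [intervalIntegral.integral_const_mul]
    change _ * M (n - m) = _
    rcases Nat.even_or_odd (n - m) with he | ho
    · have hs : Real.sin θ ^ (n - m) = (1 - Real.cos θ ^ 2) ^ ((n - m) / 2) := by
        rw [← Real.sin_sq, ← pow_mul, Nat.mul_div_cancel' he.two_dvd]
      rw [hs]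
      simp only [eval_mul, eval_C, eval_pow, eval_X, eval_sub, eval_one]
      field_simp
      ring
    · simp [hModd _ ho]

open Polynomial in
lemma exists_average (b : OrthonormalBasis (Fin 3) ℝ E3) (z : E3) (p : ℝ[X]) :
    ∃ Q : ℝ[X], Q.natDegree ≤ p.natDegree ∧ Q.eval 1 = p.eval (inner ℝ z (b 0)) ∧
      ∀ θ, ∫ φ in (-Real.pi)..Real.pi, p.eval (inner ℝ z (frameSpherePoint b θ φ)) =
        2 * Real.pi * Q.eval (Real.cos θ) := by
  choose Q hdeg h1 hint using exists_average_pow b z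
  refine ⟨∑ i ∈ Finset.range (p.natDegree + 1), C (p.coeff i) * Q i, ?_, ?_, ?_⟩
  · refine natDegree_sum_le_of_forall_le _ _ fun m hm => ?_
    rw [Finset.mem_range] at hm
    exact (natDegree_C_mul_le _ _).trans ((hdeg m).trans (by omega))
  · rw [eval_finsetSum, eval_eq_sum_range]
    exact Finset.sum_congr rfl fun i _ => by rw [eval_mul, eval_C, h1]
  · intro θ
    simp_rw [eval_eq_sum_range (p := p)]
    rw [intervalIntegral.integral_finsetSum, eval_finsetSum, Finset.mul_sum]
    · refine Finset.sum_congr rfl fun i _ => ?_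
      rw [intervalIntegral.integral_const_mul, hint, eval_mul, eval_C]
      ring
    · intro i _
      refine Continuous.intervalIntegrable ?_ _ _
      unfold frameSpherePoint
      fun_prop

open Polynomial in
/-- Averaging over circles of latitude reduces the integral over the sphere of a product of two
zonal polynomials to an integral over `[-1, 1]`. -/
lemma exists_integral_zonal_mul_zonal {e : E3} (he : ‖e‖ = 1) (z : E3) (p : ℝ[X]) :
    ∃ Q : ℝ[X], Q.natDegree ≤ p.natDegree ∧ Q.eval 1 = p.eval (inner ℝ z e) ∧
      ∀ h : ℝ[X], ∫ ξ : Sph 1, h.eval (inner ℝ e ξ) * p.eval (inner ℝ z ξ)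
          ∂(volume : Measure E3).toSphere =
        2 * Real.pi * ∫ t in (-1 : ℝ)..1, (h * Q).eval t := by
  obtain ⟨b, rfl⟩ := exists_orthonormalBasis_first he
  obtain ⟨Q, hQ, hQ1, hQi⟩ := exists_average b z p
  refine ⟨Q, hQ, hQ1, fun h => ?_⟩
  rw [integral_toSphere_eq_spherical b
    (f := fun x => h.eval (inner ℝ (b 0) x) * p.eval (inner ℝ z x)) (by fun_prop)]
  have hb : ∀ θ φ, inner ℝ (b 0) (frameSpherePoint b θ φ) = Real.cos θ := by
    intro θ φ
    simp [frameSpherePoint, inner_add_right, inner_smul_right]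
  simp_rw [hb, intervalIntegral.integral_const_mul, hQi]
  have hsub := intervalIntegral.integral_comp_mul_deriv (a := 0) (b := Real.pi) (f := Real.cos)
    (f' := fun θ => -Real.sin θ) (g := fun t => (h * Q).eval t)
    (fun θ _ => Real.hasDerivAt_cos θ) (by fun_prop) (by fun_prop)
  rw [Real.cos_zero, Real.cos_pi, intervalIntegral.integral_symm (-1 : ℝ)] at hsub
  rw [← neg_neg (∫ t in (-1 : ℝ)..1, (h * Q).eval t), ← hsub, ← intervalIntegral.integral_neg,
    ← intervalIntegral.integral_const_mul]
  refine intervalIntegral.integral_congr fun θ _ => ?_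
  simp only [Function.comp_apply, eval_mul]
  ring

open Polynomial in
/-- The Legendre expansion of a polynomial, evaluated at `1`. -/
lemma sum_integral_legendreP_mul {n : ℕ} {q : ℝ[X]} (hq : q.natDegree ≤ n) :
    ∑ j ∈ Finset.range (n + 1), (2 * (j : ℝ) + 1) / 2 *
      ∫ t in (-1 : ℝ)..1, (legendreP j * q).eval t = q.eval 1 := by
  have h := mem_span_legendreP hq
  clear hq
  induction h using Submodule.span_induction with
  | mem x hx =>
    obtain ⟨k, hk, rfl⟩ := hx
    rw [Finset.sum_eq_single_of_mem k (Finset.mem_range.2 (Nat.lt_succ_of_le hk)),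
      integral_legendreP_sq, legendreP_eval_one]
    · field_simp
    · intro j _ hj
      rw [integral_legendreP_mul_of_ne hj, mul_zero]
  | zero => simp
  | add x y _ _ hx hy =>
    rw [eval_add, ← hx, ← hy, ← Finset.sum_add_distrib]
    refine Finset.sum_congr rfl fun j _ => ?_
    simp only [mul_add, eval_add]
    rw [intervalIntegral.integral_add (intervalIntegrable_eval _ _ _)
      (intervalIntegrable_eval _ _ _)]
    ring
  | smul a x _ hx =>
    rw [eval_smul, ← hx, smul_eq_mul, Finset.mul_sum]
    refine Finset.sum_congr rfl fun j _ => ?_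
    simp only [mul_smul_comm, eval_smul, smul_eq_mul]
    rw [intervalIntegral.integral_const_mul]
    ring

lemma integral_toSphere_legendreP_of_ne {e z : E3} (he : ‖e‖ = 1) (hz : ‖z‖ = 1) {k l : ℕ}
    (hkl : k ≠ l) :
    ∫ ξ : Sph 1, (legendreP k).eval (inner ℝ e ξ) * (legendreP l).eval (inner ℝ z ξ)
      ∂(volume : Measure E3).toSphere = 0 := by
  wlog h : l < k generalizing e z k l
  · have := this hz he hkl.symm (by omega)
    simpa only [mul_comm] using this
  obtain ⟨Q, hQ, -, hQi⟩ := exists_integral_zonal_mul_zonal he z (legendreP l)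
  rw [hQi, integral_legendreP_mul_of_natDegree_lt
    ((hQ.trans (natDegree_legendreP_le l)).trans_lt h), mul_zero]

/-- The reproducing property of zonal harmonics. The latitude average of `P_l ⟪z, ·⟫` about `e` is
a polynomial of degree at most `l` orthogonal to `P_j` for `j < l`, so its value at the pole
determines its product with `P_l`. -/
lemma integral_toSphere_legendreP_self {e z : E3} (he : ‖e‖ = 1) (hz : ‖z‖ = 1) (l : ℕ) :
    ∫ ξ : Sph 1, (legendreP l).eval (inner ℝ e ξ) * (legendreP l).eval (inner ℝ z ξ)
      ∂(volume : Measure E3).toSphere =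
        4 * Real.pi / (2 * l + 1) * (legendreP l).eval (inner ℝ z e) := by
  obtain ⟨Q, hQ, hQ1, hQi⟩ := exists_integral_zonal_mul_zonal he z (legendreP l)
  have h := sum_integral_legendreP_mul (hQ.trans (natDegree_legendreP_le l))
  rw [Finset.sum_eq_single_of_mem l (by simp), hQ1] at h
  · rw [hQi, ← h]
    field_simp
    ring
  · intro j _ hj
    have h0 := integral_toSphere_legendreP_of_ne he hz hj
    rw [hQi] at h0
    have hpi : (2 * Real.pi) ≠ 0 := by positivity
    rw [(mul_eq_zero.1 h0).resolve_left hpi, mul_zero]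

end SphereAverages

/-! ### The surface measure of the sphere of radius `R` -/

section SurfaceMeasure

open scoped ENNReal

lemma norm_coe_sph {R : ℝ} (x : Sph R) : ‖(x : E3)‖ = R := mem_sphere_zero_iff_norm.1 x.2

/-- The dilation `ξ ↦ R ξ` from the unit sphere onto the sphere of radius `R`. -/
noncomputable def sphereDilation {R : ℝ} (hR : 0 < R) (ξ : Sph 1) : Sph R :=
  ⟨R • (ξ : E3), by
    rw [mem_sphere_zero_iff_norm, norm_smul, norm_coe_sph, mul_one, Real.norm_of_nonneg hR.le]⟩

lemma continuous_sphereDilation {R : ℝ} (hR : 0 < R) : Continuous (sphereDilation hR) :=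
  (continuous_subtype_val.const_smul R).subtype_mk _

lemma norm_inv_smul_coe_sph {R : ℝ} (hR : 0 < R) (x : Sph R) : ‖R⁻¹ • (x : E3)‖ = 1 := by
  rw [norm_smul, norm_coe_sph, Real.norm_of_nonneg (inv_nonneg.2 hR.le), inv_mul_cancel₀ hR.ne']

lemma surjective_sphereDilation {R : ℝ} (hR : 0 < R) :
    Function.Surjective (sphereDilation hR) := fun x =>
  ⟨⟨R⁻¹ • (x : E3), mem_sphere_zero_iff_norm.2 (norm_inv_smul_coe_sph hR x)⟩,
    Subtype.ext (smul_inv_smul₀ hR.ne' _)⟩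

lemma injective_sphereDilation {R : ℝ} (hR : 0 < R) :
    Function.Injective (sphereDilation hR) := fun x y h => by
  have h1 : R • (x : E3) = R • (y : E3) := congrArg Subtype.val h
  exact Subtype.ext (smul_right_injective E3 hR.ne' h1)

lemma surfaceMeasure_eq_map {R : ℝ} (hR : 0 < R) :
    surfaceMeasure R =
      ENNReal.ofReal (R ^ 2) • (volume : Measure E3).toSphere.map (sphereDilation hR) := by
  unfold surfaceMeasure
  congr 1
  have h : (volume : Measure E3).toSphere.map (fun ξ : Sph 1 => R • (ξ : E3)) =
      ((volume : Measure E3).toSphere.map (sphereDilation hR)).map ((↑) : Sph R → E3) := by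
    rw [Measure.map_map measurable_subtype_coe (continuous_sphereDilation hR).measurable]
    rfl
  rw [h, (MeasurableEmbedding.subtype_coe isClosed_sphere.measurableSet).comap_map]

lemma isFiniteMeasure_surfaceMeasure {R : ℝ} (hR : 0 < R) : IsFiniteMeasure (surfaceMeasure R) := by
  rw [surfaceMeasure_eq_map hR]
  exact Measure.smul_finite _ ENNReal.ofReal_ne_top

lemma nullSingletonClass_surfaceMeasure {R : ℝ} (hR : 0 < R) :
    NullSingletonClass (surfaceMeasure R) := by
  refine ⟨fun x => ?_⟩
  rw [surfaceMeasure_eq_map hR, Measure.smul_apply,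
    Measure.map_apply (continuous_sphereDilation hR).measurable (measurableSet_singleton x)]
  have : sphereDilation hR ⁻¹' {x} = {(surjective_sphereDilation hR x).choose} := by
    ext ξ
    rw [Set.mem_preimage, Set.mem_singleton_iff, Set.mem_singleton_iff,
      ← (injective_sphereDilation hR).eq_iff, (surjective_sphereDilation hR x).choose_spec]
  rw [this, measure_singleton, smul_zero]

lemma isOpenPosMeasure_surfaceMeasure {R : ℝ} (hR : 0 < R) :
    (surfaceMeasure R).IsOpenPosMeasure := by
  refine ⟨fun U hU hne => ?_⟩
  rw [surfaceMeasure_eq_map hR, Measure.smul_apply,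
    Measure.map_apply (continuous_sphereDilation hR).measurable hU.measurableSet, smul_eq_mul]
  refine mul_ne_zero (by simpa using hR.ne') ?_
  exact ((hU.preimage (continuous_sphereDilation hR)).measure_pos _
    (hne.preimage (surjective_sphereDilation hR))).ne'

lemma integral_surfaceMeasure {R : ℝ} (hR : 0 < R) {F : Sph R → ℝ} (hF : Continuous F) :
    ∫ x, F x ∂(surfaceMeasure R) =
      R ^ 2 * ∫ ξ, F (sphereDilation hR ξ) ∂(volume : Measure E3).toSphere := by
  rw [surfaceMeasure_eq_map hR, integral_smul_measure,
    integral_map (continuous_sphereDilation hR).aemeasurable hF.aestronglyMeasurable,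
    ENNReal.toReal_ofReal (sq_nonneg R), smul_eq_mul]

lemma Continuous.integrable_surfaceMeasure {R : ℝ} (hR : 0 < R) {F : Sph R → ℝ}
    (hF : Continuous F) : Integrable F (surfaceMeasure R) := by
  have := isFiniteMeasure_surfaceMeasure hR
  exact hF.integrable_of_hasCompactSupport (HasCompactSupport.of_compactSpace _)

end SurfaceMeasure

/-! ### Zonal harmonics -/

section Zonal

/-- The cosine of the central angle between two points of the sphere of radius `R`. -/
noncomputable def cosAngle {R : ℝ} (x y : Sph R) : ℝ := inner ℝ (x : E3) (y : E3) / R ^ 2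

lemma cos_centralAngle {R : ℝ} (x y : Sph R) : Real.cos (centralAngle x y) = cosAngle x y := by
  rw [centralAngle, InnerProductGeometry.cos_angle, norm_coe_sph, norm_coe_sph, cosAngle, sq]

lemma cosAngle_comm {R : ℝ} (x y : Sph R) : cosAngle x y = cosAngle y x := by
  rw [cosAngle, cosAngle, real_inner_comm]

lemma cosAngle_mem_Icc {R : ℝ} (x y : Sph R) : cosAngle x y ∈ Set.Icc (-1 : ℝ) 1 := by
  rw [← cos_centralAngle]
  exact ⟨Real.neg_one_le_cos _, Real.cos_le_one _⟩

lemma cosAngle_self {R : ℝ} (hR : 0 < R) (x : Sph R) : cosAngle x x = 1 := by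
  rw [cosAngle, real_inner_self_eq_norm_sq, norm_coe_sph, div_self (by positivity)]

lemma cosAngle_lt_one {R : ℝ} (hR : 0 < R) {x y : Sph R} (h : x ≠ y) : cosAngle x y < 1 := by
  have h1 : 0 < ‖(x : E3) - y‖ ^ 2 := by
    have : (x : E3) - y ≠ 0 := sub_ne_zero.2 fun e => h (Subtype.ext e)
    positivity
  rw [norm_sub_sq_real, norm_coe_sph, norm_coe_sph] at h1
  rw [cosAngle, div_lt_one (by positivity)]
  linarith

lemma continuous_cosAngle {R : ℝ} : Continuous fun p : Sph R × Sph R => cosAngle p.1 p.2 := by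
  unfold cosAngle
  fun_prop

/-- The zonal harmonic `x ↦ P_l (cos γ(y, x))` of degree `l` with pole `y`. -/
noncomputable def zonal {R : ℝ} (l : ℕ) (y x : Sph R) : ℝ := (legendreP l).eval (cosAngle y x)

lemma continuous_zonal {R : ℝ} (l : ℕ) : Continuous fun p : Sph R × Sph R => zonal l p.1 p.2 :=
  (legendreP l).continuous.comp continuous_cosAngle

lemma continuous_zonal_right {R : ℝ} (l : ℕ) (y : Sph R) : Continuous (zonal l y) :=
  (continuous_zonal l).comp (Continuous.prodMk_right y)

lemma cosAngle_sphereDilation {R : ℝ} (hR : 0 < R) (y : Sph R) (ξ : Sph 1) :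
    cosAngle y (sphereDilation hR ξ) = inner ℝ (R⁻¹ • (y : E3)) (ξ : E3) := by
  rw [cosAngle, sphereDilation, inner_smul_right, real_inner_smul_left]
  field_simp

lemma integral_zonal_mul_zonal_of_ne {R : ℝ} (hR : 0 < R) {k l : ℕ} (h : k ≠ l) (y z : Sph R) :
    ∫ x, zonal k y x * zonal l z x ∂(surfaceMeasure R) = 0 := by
  rw [integral_surfaceMeasure hR (F := fun x => zonal k y x * zonal l z x)
    ((continuous_zonal_right k y).mul (continuous_zonal_right l z))]
  simp only [zonal, cosAngle_sphereDilation]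
  rw [integral_toSphere_legendreP_of_ne (norm_inv_smul_coe_sph hR y) (norm_inv_smul_coe_sph hR z) h,
    mul_zero]

lemma integral_zonal_mul_zonal_self {R : ℝ} (hR : 0 < R) (l : ℕ) (y z : Sph R) :
    ∫ x, zonal l y x * zonal l z x ∂(surfaceMeasure R) =
      4 * Real.pi * R ^ 2 / (2 * l + 1) * zonal l z y := by
  rw [integral_surfaceMeasure hR (F := fun x => zonal l y x * zonal l z x)
    ((continuous_zonal_right l y).mul (continuous_zonal_right l z))]
  simp only [zonal, cosAngle_sphereDilation]
  rw [integral_toSphere_legendreP_self (norm_inv_smul_coe_sph hR y) (norm_inv_smul_coe_sph hR z),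
    cosAngle, real_inner_smul_left, inner_smul_right]
  field_simp

end Zonal

/-! ### The Laplace-Beltrami operator and the maximum principle -/

section LaplaceBeltrami

lemma coe_sph_ne_zero {R : ℝ} (hR : 0 < R) (x : Sph R) : (x : E3) ≠ 0 := by
  rw [← norm_pos_iff, norm_coe_sph]
  exact hR

lemma SphereContDiff.contDiffAt {R : ℝ} {n : WithTop ℕ∞} {u : Sph R → ℝ}
    (hu : SphereContDiff R n u) {x : E3} (hx : x ≠ 0) :
    ContDiffAt ℝ n (radialExtension R u) x :=
  ContDiffOn.contDiffAt hu (isOpen_compl_singleton.mem_nhds hx)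

lemma SphereContDiff.of_le {R : ℝ} {m n : WithTop ℕ∞} {u : Sph R → ℝ}
    (hu : SphereContDiff R n u) (h : m ≤ n) : SphereContDiff R m u :=
  ContDiffOn.of_le hu h

lemma SphereContDiff.continuous {R : ℝ} (hR : 0 < R) {n : WithTop ℕ∞} {u : Sph R → ℝ}
    (hu : SphereContDiff R n u) : Continuous u := by
  have h : u = fun x : Sph R => radialExtension R u x :=
    funext fun x => (radialExtension_coe hR u x).symm
  rw [h]
  exact ContDiffOn.continuousOn hu |>.comp_continuous continuous_subtype_val
    fun x => coe_sph_ne_zero hR x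

lemma radialExtension_add (R : ℝ) (u v : Sph R → ℝ) :
    radialExtension R (u + v) = radialExtension R u + radialExtension R v := by
  funext x
  simp only [radialExtension, Pi.add_apply]
  rw [← Pi.add_apply, ← Function.extend_add, add_zero]

lemma radialExtension_const_smul (R a : ℝ) (u : Sph R → ℝ) :
    radialExtension R (a • u) = a • radialExtension R u := by
  funext x
  simp only [radialExtension, Pi.smul_apply]
  rw [← Pi.smul_apply, ← Function.extend_smul, smul_zero]

lemma SphereContDiff.add {R : ℝ} {n : WithTop ℕ∞} {u v : Sph R → ℝ}
    (hu : SphereContDiff R n u) (hv : SphereContDiff R n v) : SphereContDiff R n (u + v) := by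
  rw [SphereContDiff, radialExtension_add]
  exact ContDiffOn.add hu hv

lemma SphereContDiff.const_smul {R : ℝ} {n : WithTop ℕ∞} {u : Sph R → ℝ}
    (hu : SphereContDiff R n u) (a : ℝ) : SphereContDiff R n (a • u) := by
  rw [SphereContDiff, radialExtension_const_smul]
  exact ContDiffOn.const_smul a hu

lemma laplaceBeltrami_add {R : ℝ} (hR : 0 < R) {u v : Sph R → ℝ}
    (hu : SphereContDiff R 2 u) (hv : SphereContDiff R 2 v) (x : Sph R) :
    laplaceBeltrami R (u + v) x = laplaceBeltrami R u x + laplaceBeltrami R v x := by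
  simp only [laplaceBeltrami]
  rw [radialExtension_add, ContDiffAt.laplacian_add (hu.contDiffAt (coe_sph_ne_zero hR x))
    (hv.contDiffAt (coe_sph_ne_zero hR x))]

lemma laplaceBeltrami_const_smul {R : ℝ} (hR : 0 < R) {u : Sph R → ℝ}
    (hu : SphereContDiff R 2 u) (a : ℝ) (x : Sph R) :
    laplaceBeltrami R (a • u) x = a * laplaceBeltrami R u x := by
  simp only [laplaceBeltrami]
  rw [radialExtension_const_smul,
    InnerProductSpace.laplacian_smul a (hu.contDiffAt (coe_sph_ne_zero hR x)), smul_eq_mul]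

lemma radialExtension_of_ne_zero {R : ℝ} (hR : 0 < R) (u : Sph R → ℝ) {x : E3} (hx : x ≠ 0) :
    ∃ y : Sph R, (y : E3) = (R / ‖x‖) • x ∧ radialExtension R u x = u y := by
  have h : (R / ‖x‖) • x ∈ sphere (0 : E3) R := by
    rw [mem_sphere_zero_iff_norm, norm_smul, Real.norm_of_nonneg (by positivity)]
    field_simp
  exact ⟨⟨_, h⟩, rfl, Subtype.val_injective.extend_apply u 0 ⟨_, h⟩⟩

lemma continuous_laplaceBeltrami {R : ℝ} (hR : 0 < R) {u : Sph R → ℝ}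
    (hu : SphereContDiff R 2 u) : Continuous (laplaceBeltrami R u) := by
  have h : laplaceBeltrami R u = fun x : Sph R => ∑ i, iteratedFDeriv ℝ 2 (radialExtension R u) x
      ![stdOrthonormalBasis ℝ E3 i, stdOrthonormalBasis ℝ E3 i] := by
    funext x
    rw [laplaceBeltrami, InnerProductSpace.laplacian_eq_iteratedFDeriv_stdOrthonormalBasis]
  rw [h]
  refine continuous_finsetSum _ fun i _ => ?_
  refine continuous_iff_continuousAt.2 fun x => ?_
  have h1 : ContinuousAt (iteratedFDeriv ℝ 2 (radialExtension R u)) (x : E3) :=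
    (hu.contDiffAt (coe_sph_ne_zero hR x)).continuousAt_iteratedFDeriv (by norm_num)
  exact (ContinuousMultilinearMap.apply ℝ (fun _ : Fin 2 => E3) ℝ
    ![stdOrthonormalBasis ℝ E3 i, stdOrthonormalBasis ℝ E3 i]).continuous.continuousAt.comp
      (h1.comp (f := ((↑) : Sph R → E3)) continuous_subtype_val.continuousAt)

/-- At a maximum the second derivatives of the radial extension are nonpositive. -/
lemma laplaceBeltrami_nonpos_of_isMax {R : ℝ} (hR : 0 < R) {u : Sph R → ℝ}
    (hu : SphereContDiff R 2 u) {x : Sph R} (hx : ∀ y, u y ≤ u x) :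
    laplaceBeltrami R u x ≤ 0 := by
  rw [laplaceBeltrami, InnerProductSpace.laplacian_eq_iteratedFDeriv_stdOrthonormalBasis]
  refine Finset.sum_nonpos fun i _ => ?_
  set e := stdOrthonormalBasis ℝ E3 i
  set Φ := radialExtension R u with hΦ
  set c : ℝ → E3 := fun t => (x : E3) + t • e with hc
  have hc0 : c 0 = x := by simp [hc]
  have hcont : Continuous c := by fun_prop
  have hdc : ∀ t, HasDerivAt c e t := fun t => by
    simpa [hc] using ((hasDerivAt_id t).smul_const e).const_add (x : E3)
  have hne : ∀ᶠ t in 𝓝 (0 : ℝ), c t ≠ 0 :=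
    hcont.continuousAt.eventually_ne (by rw [hc0]; exact coe_sph_ne_zero hR x)
  have hd1 : ∀ᶠ t in 𝓝 (0 : ℝ), deriv (fun s => Φ (c s)) t = fderiv ℝ Φ (c t) e := by
    filter_upwards [hne] with t ht
    exact (hasDerivAt_comp_curve₁ (hu.contDiffAt ht) (hdc t)).deriv
  have hd2 : deriv (deriv fun s => Φ (c s)) 0 = iteratedFDeriv ℝ 2 Φ x ![e, e] := by
    rw [EventuallyEq.deriv_eq hd1]
    have := hasDerivAt_comp_curve (c₁ := fun _ => e)
      (hu.contDiffAt (by rw [hc0]; exact coe_sph_ne_zero hR x)) (hdc 0) (hasDerivAt_const 0 e)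
    rw [this.deriv, hc0, map_zero, add_zero]
  have hmax : ∀ᶠ t in 𝓝 (0 : ℝ), Φ (c t) ≤ Φ (c 0) := by
    filter_upwards [hne] with t ht
    obtain ⟨y, -, hy⟩ := radialExtension_of_ne_zero hR u ht
    rw [hc0, hΦ, hy, radialExtension_coe hR]
    exact hx y
  have hloc : IsLocalMax (fun s => Φ (c s)) 0 := hmax
  by_contra hpos
  rw [← hd2, not_le] at hpos
  -- a positive second derivative would make `0` a local minimum too, so `Φ ∘ c` would be constant
  have hmin := isLocalMin_of_deriv_deriv_pos hpos hloc.deriv_eq_zero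
    (hasDerivAt_comp_curve₁ (c := c) (t := 0)
      (hu.contDiffAt (by rw [hc0]; exact coe_sph_ne_zero hR x)) (hdc 0)).continuousAt
  have hconst : (fun s => Φ (c s)) =ᶠ[𝓝 0] fun _ => Φ (c 0) := by
    filter_upwards [hmin, hmax] with t h1 h2
    exact le_antisymm h2 h1
  have h0 : deriv (fun s => Φ (c s)) =ᶠ[𝓝 0] fun _ => 0 := by
    filter_upwards [hconst.eventuallyEq_nhds] with t ht
    rw [ht.deriv_eq, deriv_const]
  rw [h0.deriv_eq, deriv_const] at hpos
  exact lt_irrefl _ hpos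

lemma le_of_screened_ge {R L ε : ℝ} (hR : 0 < R) (hL : 0 < L) {u : Sph R → ℝ}
    (hu : SphereContDiff R 2 u) (h : ∀ x, -ε ≤ laplaceBeltrami R u x - u x / L ^ 2) (x : Sph R) :
    u x ≤ ε * L ^ 2 := by
  obtain ⟨x₀, -, hx₀⟩ := isCompact_univ.exists_isMaxOn ⟨x, Set.mem_univ x⟩
    (hu.continuous hR).continuousOn
  have h1 := laplaceBeltrami_nonpos_of_isMax hR hu (x := x₀) fun y => hx₀ (Set.mem_univ y)
  have h2 : u x₀ / L ^ 2 ≤ ε := by linarith [h x₀]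
  exact (hx₀ (Set.mem_univ x)).trans ((div_le_iff₀ (by positivity)).1 h2)

/-- The maximum principle: the screened Laplacian controls the supremum norm. -/
lemma abs_le_of_abs_screened_le {R L ε : ℝ} (hR : 0 < R) (hL : 0 < L) {u : Sph R → ℝ}
    (hu : SphereContDiff R 2 u) (h : ∀ x, |laplaceBeltrami R u x - u x / L ^ 2| ≤ ε) (x : Sph R) :
    |u x| ≤ ε * L ^ 2 := by
  refine abs_le'.2 ⟨le_of_screened_ge hR hL hu (fun y => (abs_le.1 (h y)).1) x, ?_⟩
  have := le_of_screened_ge (ε := ε) hR hL (hu.const_smul (-1)) (fun y => ?_) x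
  · simpa using this
  · rw [laplaceBeltrami_const_smul hR hu]
    have := (abs_le.1 (h y)).2
    simp only [Pi.smul_apply, smul_eq_mul, neg_mul, one_mul, neg_div]
    linarith

end LaplaceBeltrami

/-! ### Zonal harmonics as eigenfunctions -/

section ZonalLaplacian

lemma two_le_smooth : (2 : WithTop ℕ∞) ≤ ∞ := WithTop.coe_le_coe.2 (le_top : (2 : ℕ∞) ≤ ⊤)

lemma fderiv_radialExtension_self {R : ℝ} (hR : 0 < R) {u : Sph R → ℝ}
    (hu : SphereContDiff R 2 u) (x : Sph R) :
    fderiv ℝ (radialExtension R u) x (x : E3) = 0 := by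
  have hd : HasDerivAt (fun s : ℝ => s • (x : E3)) (x : E3) 1 := by
    simpa using (hasDerivAt_id (1 : ℝ)).smul_const (x : E3)
  have h := hasDerivAt_comp_curve₁ (Φ := radialExtension R u) (c := fun s : ℝ => s • (x : E3))
    (t := 1) (by rw [one_smul]; exact hu.contDiffAt (coe_sph_ne_zero hR x)) hd
  rw [one_smul] at h
  refine h.unique ((hasDerivAt_const 1 (radialExtension R u x)).congr_of_eventuallyEq ?_)
  filter_upwards [lt_mem_nhds one_pos] with s hs
  exact radialExtension_smul R u _ hs

lemma iteratedFDeriv_radialExtension_self {R : ℝ} (hR : 0 < R) {u : Sph R → ℝ}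
    (hu : SphereContDiff R 2 u) (x : Sph R) :
    iteratedFDeriv ℝ 2 (radialExtension R u) x ![(x : E3), (x : E3)] = 0 := by
  have hd : ∀ t : ℝ, HasDerivAt (fun s : ℝ => s • (x : E3)) (x : E3) t := fun t => by
    simpa using (hasDerivAt_id t).smul_const (x : E3)
  have hC : ∀ t : ℝ, 0 < t → ContDiffAt ℝ 2 (radialExtension R u) (t • (x : E3)) := fun t ht =>
    hu.contDiffAt (smul_ne_zero ht.ne' (coe_sph_ne_zero hR x))
  have h := hasDerivAt_comp_curve (Φ := radialExtension R u) (c := fun s : ℝ => s • (x : E3))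
    (c₁ := fun _ => (x : E3)) (hC 1 one_pos) (hd 1) (hasDerivAt_const 1 (x : E3))
  rw [one_smul, map_zero, add_zero] at h
  refine h.unique ((hasDerivAt_const 1 (0 : ℝ)).congr_of_eventuallyEq ?_)
  filter_upwards [lt_mem_nhds one_pos] with s hs
  have h1 := hasDerivAt_comp_curve₁ (c := fun s : ℝ => s • (x : E3)) (hC s hs) (hd s)
  refine h1.unique ((hasDerivAt_const s (radialExtension R u x)).congr_of_eventuallyEq ?_)
  filter_upwards [lt_mem_nhds hs] with r hr
  exact radialExtension_smul R u _ hr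

/-- The second derivative of the radial extension in a tangential direction is the second
derivative of the function along the corresponding great circle. -/
lemma iteratedFDeriv_radialExtension_tangent {R : ℝ} (hR : 0 < R) {u : Sph R → ℝ}
    (hu : SphereContDiff R 2 u) {x : Sph R} {e : E3} (he : ‖e‖ = 1)
    (hxe : inner ℝ (x : E3) e = 0) {g g₁ : ℝ → ℝ} {g₂ : ℝ}
    (hg : ∀ t, ∀ y : Sph R, (y : E3) = Real.cos t • (x : E3) + (R * Real.sin t) • e → u y = g t)
    (hg₁ : ∀ t, HasDerivAt g (g₁ t) t) (hg₂ : HasDerivAt g₁ g₂ 0) :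
    R ^ 2 * iteratedFDeriv ℝ 2 (radialExtension R u) x ![e, e] = g₂ := by
  set c : ℝ → E3 := fun t => Real.cos t • (x : E3) + (R * Real.sin t) • e with hc
  set c₁ : ℝ → E3 := fun t => -Real.sin t • (x : E3) + (R * Real.cos t) • e with hc₁
  have hn : ∀ t, ‖c t‖ = R := by
    intro t
    rw [← sq_eq_sq₀ (norm_nonneg _) hR.le, hc, norm_add_sq_real, norm_smul, norm_smul,
      norm_coe_sph, he, real_inner_smul_left, inner_smul_right, hxe, mul_pow, mul_pow,
      Real.norm_eq_abs, Real.norm_eq_abs, sq_abs, sq_abs]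
    linear_combination R ^ 2 * Real.sin_sq_add_cos_sq t
  have hC : ∀ t, ContDiffAt ℝ 2 (radialExtension R u) (c t) := fun t =>
    hu.contDiffAt (norm_pos_iff.1 (by rw [hn]; exact hR))
  have hd : ∀ t, HasDerivAt c (c₁ t) t := fun t =>
    ((Real.hasDerivAt_cos t).smul_const _).add
      (((Real.hasDerivAt_sin t).const_mul R).smul_const e)
  have hd₁ : HasDerivAt c₁ (-(x : E3)) 0 := by
    have := (((Real.hasDerivAt_sin 0).neg).smul_const (x : E3)).add
      (((Real.hasDerivAt_cos 0).const_mul R).smul_const e)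
    refine this.congr_deriv ?_
    simp
  have hv : ∀ t, radialExtension R u (c t) = g t := fun t => by
    have h := radialExtension_coe hR u ⟨c t, mem_sphere_zero_iff_norm.2 (hn t)⟩
    exact h.trans (hg t _ rfl)
  have h1 : ∀ t, fderiv ℝ (radialExtension R u) (c t) (c₁ t) = g₁ t := fun t => by
    refine (hasDerivAt_comp_curve₁ (hC t) (hd t)).unique ?_
    simp_rw [hv]
    exact hg₁ t
  have h2 := hasDerivAt_comp_curve (hC 0) (hd 0) hd₁
  simp_rw [h1] at h2
  have h3 := h2.unique hg₂
  have hc0 : c 0 = x := by simp [hc]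
  have hc10 : c₁ 0 = R • e := by simp [hc₁]
  rw [hc0, hc10, map_neg, fderiv_radialExtension_self hR hu, neg_zero, add_zero] at h3
  rw [← h3, iteratedFDeriv_two_apply, iteratedFDeriv_two_apply]
  simp
  ring

lemma laplaceBeltrami_eq_tangent {R : ℝ} (hR : 0 < R) {u : Sph R → ℝ}
    (hu : SphereContDiff R 2 u) {x : Sph R} (b : OrthonormalBasis (Fin 3) ℝ E3)
    (hb : b 0 = R⁻¹ • (x : E3)) :
    laplaceBeltrami R u x = iteratedFDeriv ℝ 2 (radialExtension R u) x ![b 1, b 1] +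
      iteratedFDeriv ℝ 2 (radialExtension R u) x ![b 2, b 2] := by
  rw [laplaceBeltrami, InnerProductSpace.laplacian_eq_iteratedFDeriv_orthonormalBasis _ b]
  have h := iteratedFDeriv_radialExtension_self hR hu x
  simp only [Fin.sum_univ_three]
  have h0 : iteratedFDeriv ℝ 2 (radialExtension R u) x ![b 0, b 0] = 0 := by
    rw [iteratedFDeriv_two_apply] at h ⊢
    simp only [Matrix.cons_val_zero, Matrix.cons_val_one] at h ⊢
    rw [hb, map_smul, map_smul, smul_apply, h]
    simp
  rw [h0, zero_add]

lemma sphereContDiff_zonal {R : ℝ} (hR : 0 < R) (l : ℕ) (z : Sph R) :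
    SphereContDiff R ∞ (zonal l z) := by
  have h : ∀ x ∈ ({0}ᶜ : Set E3), radialExtension R (zonal l z) x =
      (legendreP l).eval (inner ℝ (z : E3) ((R / ‖x‖) • x) / R ^ 2) := by
    intro x hx
    obtain ⟨y, hy, hy'⟩ := radialExtension_of_ne_zero hR (zonal l z) hx
    rw [hy', zonal, cosAngle, hy]
  refine ContDiffOn.congr ?_ h
  have hp : ContDiff ℝ ∞ fun t : ℝ => (legendreP l).eval t := by
    simpa using Polynomial.contDiff_aeval (𝕜 := ℝ) (legendreP l) ∞
  have hn : ContDiffOn ℝ ∞ (fun x : E3 => ‖x‖) {0}ᶜ := fun x hx =>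
    (contDiffAt_norm ℝ hx).contDiffWithinAt
  have hq : ContDiffOn ℝ ∞ (fun x : E3 => R / ‖x‖) {0}ᶜ :=
    contDiffOn_const.div hn fun x hx => norm_ne_zero_iff.2 hx
  have hin : ContDiffOn ℝ ∞ (fun x : E3 => inner ℝ (z : E3) ((R / ‖x‖) • x)) {0}ᶜ :=
    contDiffOn_const.inner ℝ (hq.smul contDiffOn_id)
  exact hp.comp_contDiffOn (hin.div_const _)

/-- Zonal harmonics are eigenfunctions of the Laplace-Beltrami operator. -/
lemma laplaceBeltrami_zonal {R : ℝ} (hR : 0 < R) (l : ℕ) (z x : Sph R) :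
    laplaceBeltrami R (zonal l z) x = -((l : ℝ) * (l + 1)) / R ^ 2 * zonal l z x := by
  have hu : SphereContDiff R 2 (zonal l z) := (sphereContDiff_zonal hR l z).of_le two_le_smooth
  obtain ⟨b, hb⟩ := exists_orthonormalBasis_first (norm_inv_smul_coe_sph hR x)
  set p := legendreP l with hp
  set t := cosAngle z x with ht
  have htan : ∀ i, i ≠ 0 → R ^ 2 * iteratedFDeriv ℝ 2 (radialExtension R (zonal l z)) x
      ![b i, b i] = p.derivative.derivative.eval t * (inner ℝ (z : E3) (b i) / R) ^ 2 -
        p.derivative.eval t * t := by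
    intro i hi
    set s := inner ℝ (z : E3) (b i) / R with hs
    have hxb : inner ℝ (x : E3) (b i) = 0 := by
      have h0 : inner ℝ (b 0) (b i) = 0 := b.inner_eq_zero hi.symm
      rw [hb, real_inner_smul_left] at h0
      exact (mul_eq_zero.1 h0).resolve_left (inv_ne_zero hR.ne')
    have hin : ∀ τ, HasDerivAt (fun τ => t * Real.cos τ + s * Real.sin τ)
        (t * -Real.sin τ + s * Real.cos τ) τ := fun τ =>
      ((Real.hasDerivAt_cos τ).const_mul t).add ((Real.hasDerivAt_sin τ).const_mul s)
    have hin₁ : ∀ τ, HasDerivAt (fun τ => t * -Real.sin τ + s * Real.cos τ)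
        (t * -Real.cos τ + s * -Real.sin τ) τ := fun τ =>
      ((Real.hasDerivAt_sin τ).neg.const_mul t).add ((Real.hasDerivAt_cos τ).const_mul s)
    refine iteratedFDeriv_radialExtension_tangent hR hu (b.norm_eq_one i) hxb
      (g := fun τ => p.eval (t * Real.cos τ + s * Real.sin τ))
      (g₁ := fun τ => p.derivative.eval (t * Real.cos τ + s * Real.sin τ) *
        (t * -Real.sin τ + s * Real.cos τ)) ?_ ?_ ?_
    · intro τ y hy
      rw [zonal, cosAngle, hy, inner_add_right, inner_smul_right, inner_smul_right, ht, hs,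
        cosAngle, hp]
      congr 1
      field_simp
    · intro τ
      exact (p.hasDerivAt _).comp τ (hin τ)
    · have h := ((p.derivative.hasDerivAt _).comp (0 : ℝ) (hin 0)).mul (hin₁ 0)
      refine h.congr_deriv ?_
      simp
      ring
  have h1 := htan 1 (by decide)
  have h2 := htan 2 (by decide)
  have hpars : t ^ 2 + (inner ℝ (z : E3) (b 1) / R) ^ 2 + (inner ℝ (z : E3) (b 2) / R) ^ 2 = 1 := by
    have h := b.sum_sq_inner_left (z : E3)
    rw [Fin.sum_univ_three, norm_coe_sph, hb, inner_smul_right] at h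
    rw [ht, cosAngle, div_pow, div_pow, div_pow]
    field_simp at h ⊢
    linarith
  have hode : (1 - t ^ 2) * p.derivative.derivative.eval t - 2 * t * p.derivative.eval t =
      -((l : ℝ) * (l + 1)) * p.eval t := by
    have h := congrArg (Polynomial.eval t) (legendreP_ode l)
    rw [Polynomial.derivative_mul] at h
    simp at h
    rw [← hp] at h
    linarith
  rw [laplaceBeltrami_eq_tangent hR hu b hb, zonal, ← ht, ← hp, div_mul_eq_mul_div,
    eq_div_iff (by positivity)]
  linear_combination h1 + h2 + hode + p.derivative.derivative.eval t * hpars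

end ZonalLaplacian

/-! ### Density of the zonal harmonics -/

section Density

/-- The span of the zonal harmonics in the space of continuous functions on the sphere. -/
noncomputable def zonalSpan (R : ℝ) : Submodule ℝ C(Sph R, ℝ) :=
  Submodule.span ℝ (Set.range fun q : ℕ × Sph R => ⟨zonal q.1 q.2, continuous_zonal_right q.1 q.2⟩)

/-- The restriction of the linear form `⟪w, ·⟫` to the sphere. -/
noncomputable def sphereLinearForm (R : ℝ) (w : E3) : C(Sph R, ℝ) :=
  ⟨fun x => inner ℝ w (x : E3), by fun_prop⟩

lemma sphereLinearForm_add (R : ℝ) (w w' : E3) :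
    sphereLinearForm R (w + w') = sphereLinearForm R w + sphereLinearForm R w' := by
  ext x
  simp [sphereLinearForm, inner_add_left]

lemma sphereLinearForm_pow_mem {R : ℝ} (hR : 0 < R) (w : E3) (n : ℕ) :
    sphereLinearForm R w ^ n ∈ zonalSpan R := by
  -- a nonzero `w` is a multiple of a point `z` of the sphere
  obtain ⟨z, a, hza⟩ : ∃ (z : Sph R) (a : ℝ), w = a • (z : E3) := by
    rcases eq_or_ne w 0 with rfl | hw
    · obtain ⟨v, hv⟩ := (NormedSpace.sphere_nonempty (E := E3) (x := 0) (r := R)).2 hR.le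
      exact ⟨⟨v, hv⟩, 0, by simp⟩
    · refine ⟨⟨(R / ‖w‖) • w, ?_⟩, ‖w‖ / R, ?_⟩
      · rw [mem_sphere_zero_iff_norm, norm_smul, Real.norm_of_nonneg (by positivity)]
        field_simp
      · have : ‖w‖ ≠ 0 := norm_ne_zero_iff.2 hw
        rw [smul_smul, div_mul_div_cancel₀ hR.ne', div_self this, one_smul]
  have key : ∀ p ∈ Submodule.span ℝ (legendreP '' Set.Iic n),
      (⟨fun x => p.eval (cosAngle z x), p.continuous.comp
        (continuous_cosAngle.comp (Continuous.prodMk_right z))⟩ : C(Sph R, ℝ)) ∈ zonalSpan R := by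
    intro p hp
    induction hp using Submodule.span_induction with
    | mem p hp =>
      obtain ⟨j, -, rfl⟩ := hp
      exact Submodule.subset_span ⟨(j, z), rfl⟩
    | zero =>
      convert (zonalSpan R).zero_mem using 1
      ext x
      simp
    | add p q _ _ hp hq =>
      convert (zonalSpan R).add_mem hp hq using 1
      ext x
      simp
    | smul c p _ hp =>
      convert (zonalSpan R).smul_mem c hp using 1
      ext x
      simp
  have h := (zonalSpan R).smul_mem ((a * R ^ 2) ^ n)
    (key (Polynomial.X ^ n) (mem_span_legendreP (by simp)))
  convert h using 1
  ext x
  simp only [sphereLinearForm, ContinuousMap.pow_apply, ContinuousMap.coe_mk, hza,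
    real_inner_smul_left, ContinuousMap.smul_apply, Polynomial.eval_pow, Polynomial.eval_X,
    smul_eq_mul, cosAngle]
  rw [← mul_pow]
  congr 1
  field_simp

/-- The zonal harmonics span a dense subspace: its closure contains the exponentials of linear
forms, whose span is an algebra that separates points. -/
theorem topologicalClosure_zonalSpan {R : ℝ} (hR : 0 < R) :
    (zonalSpan R).topologicalClosure = ⊤ := by
  have hexp : ∀ w, NormedSpace.exp (sphereLinearForm R w) ∈ (zonalSpan R).topologicalClosure := by
    intro w
    have hs := NormedSpace.exp_series_hasSum_exp' (𝕂 := ℝ) (sphereLinearForm R w)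
    refine (zonalSpan R).isClosed_topologicalClosure.mem_of_tendsto hs
      (Eventually.of_forall fun s => ?_)
    exact (zonalSpan R).le_topologicalClosure (Submodule.sum_mem _ fun n _ =>
      Submodule.smul_mem _ _ (sphereLinearForm_pow_mem hR w n))
  let M : Submonoid C(Sph R, ℝ) :=
    { carrier := Set.range fun w => NormedSpace.exp (sphereLinearForm R w)
      one_mem' := ⟨0, by
        have : sphereLinearForm R 0 = 0 := by ext x; simp [sphereLinearForm]
        simp only [this, NormedSpace.exp_zero]⟩
      mul_mem' := by
        rintro _ _ ⟨w, rfl⟩ ⟨w', rfl⟩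
        exact ⟨w + w', by
          simp only [sphereLinearForm_add]
          exact NormedSpace.exp_add⟩ }
  set A : Subalgebra ℝ C(Sph R, ℝ) := Algebra.adjoin ℝ (M : Set C(Sph R, ℝ)) with hA
  have hAle : Subalgebra.toSubmodule A ≤ (zonalSpan R).topologicalClosure := by
    rw [hA, Algebra.adjoin_eq_span, Submonoid.closure_eq, Submodule.span_le]
    rintro _ ⟨w, rfl⟩
    exact hexp w
  have heval : ∀ w (x : Sph R), NormedSpace.exp (sphereLinearForm R w) x =
      Real.exp (inner ℝ w (x : E3)) := by
    intro w x
    have := NormedSpace.map_exp (ContinuousMap.evalAlgHom ℝ ℝ x)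
      (continuous_eval_const x) (sphereLinearForm R w)
    rw [Real.exp_eq_exp_ℝ]
    exact this
  have hsep : A.SeparatesPoints := by
    intro x y hxy
    refine ⟨_, ⟨NormedSpace.exp (sphereLinearForm R (x - y : E3)),
      Algebra.subset_adjoin ⟨_, rfl⟩, rfl⟩, ?_⟩
    simp only [heval]
    intro h
    have h1 := Real.exp_injective h
    have h2 : inner ℝ ((x : E3) - y) ((x : E3) - y) = 0 := by
      rw [inner_sub_right, h1, sub_self]
    exact hxy (Subtype.ext (sub_eq_zero.1 (inner_self_eq_zero.1 h2)))
  have hdense := ContinuousMap.subalgebra_topologicalClosure_eq_top_of_separatesPoints A hsep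
  rw [eq_top_iff]
  intro f _
  have hf : f ∈ A.topologicalClosure := by rw [hdense]; trivial
  have hf' : f ∈ closure (Subalgebra.toSubmodule A : Set C(Sph R, ℝ)) := hf
  exact closure_minimal hAle (zonalSpan R).isClosed_topologicalClosure hf'

end Density

/-! ### The Legendre series off the diagonal -/

section LegendreSeries

/-- The coefficient `1 / (l (l + 1) + c)`; the Green's function has `c = R² / L²`. -/
noncomputable def greenCoeff (c : ℝ) (l : ℕ) : ℝ := 1 / ((l : ℝ) * ((l : ℝ) + 1) + c)

/-- The flux `l (P_{l-1} - P_l)`, whose increments are `(2l + 1) (1 - t) P_l` by Bonnet's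
recurrence. At `l = 0` the truncated index is harmless, since the factor `l` vanishes. -/
noncomputable def legendreFlux (l : ℕ) (t : ℝ) : ℝ :=
  (l : ℝ) * ((legendreP (l - 1)).eval t - (legendreP l).eval t)

lemma legendreFlux_succ_sub (l : ℕ) (t : ℝ) :
    legendreFlux (l + 1) t - legendreFlux l t =
      (2 * (l : ℝ) + 1) * ((1 - t) * (legendreP l).eval t) := by
  cases l with
  | zero => simp [legendreFlux, legendreP_zero, legendreP_one]
  | succ n =>
    have h := legendreP_eval_recurrence n t
    simp only [legendreFlux, Nat.add_sub_cancel]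
    push_cast
    linear_combination -h

lemma abs_legendreFlux_le (l : ℕ) {t : ℝ} (ht : t ∈ Set.Icc (-1 : ℝ) 1) :
    |legendreFlux l t| ≤ 2 * l := by
  rw [legendreFlux, abs_mul, abs_of_nonneg (Nat.cast_nonneg l), mul_comm (2 : ℝ)]
  refine mul_le_mul_of_nonneg_left ((abs_sub _ _).trans ?_) (Nat.cast_nonneg l)
  linarith [abs_legendreP_eval_le_one (l - 1) ht, abs_legendreP_eval_le_one l ht]

lemma greenCoeff_pos {c : ℝ} (hc : 0 < c) (l : ℕ) : 0 < greenCoeff c l := by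
  unfold greenCoeff
  positivity

lemma exists_greenCoeff_le {c : ℝ} (hc : 0 < c) :
    ∃ K, 0 < K ∧ ∀ l : ℕ, greenCoeff c l ≤ K / ((l : ℝ) + 1) ^ 2 := by
  refine ⟨2 + 1 / c, by positivity, fun l => ?_⟩
  have hl : (0 : ℝ) ≤ l := Nat.cast_nonneg l
  rw [greenCoeff, div_le_div_iff₀ (by positivity) (by positivity)]
  have h1 : 1 / c * c = 1 := one_div_mul_cancel hc.ne'
  have h2 : 0 < 1 / c := by positivity
  nlinarith [mul_nonneg hl hl, mul_nonneg h2.le (mul_nonneg hl hl), mul_nonneg h2.le hl,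
    mul_nonneg hc.le hl]

lemma greenCoeff_sub_succ {c : ℝ} (hc : 0 < c) (l : ℕ) :
    greenCoeff c l - greenCoeff c (l + 1) =
      2 * ((l : ℝ) + 1) * (greenCoeff c l * greenCoeff c (l + 1)) := by
  have h1 : (l : ℝ) * (l + 1) + c ≠ 0 := by positivity
  have h2 : ((l : ℝ) + 1) * (l + 1 + 1) + c ≠ 0 := by positivity
  unfold greenCoeff
  push_cast
  field_simp
  ring

lemma summable_inv_succ_sq : Summable fun l : ℕ => 1 / ((l : ℝ) + 1) ^ 2 := by
  have h := (summable_nat_add_iff 1).2 (Real.summable_one_div_nat_pow (p := 2).2 one_lt_two)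
  simpa using h

/-- Summation by parts for the Legendre series of the Green's function. -/
lemma one_sub_mul_sum_greenCoeff (c t : ℝ) (N : ℕ) :
    (1 - t) * ∑ l ∈ Finset.range N, (2 * (l : ℝ) + 1) * greenCoeff c l * (legendreP l).eval t =
      greenCoeff c N * legendreFlux N t + ∑ l ∈ Finset.range N,
        (greenCoeff c l - greenCoeff c (l + 1)) * legendreFlux (l + 1) t := by
  induction N with
  | zero => simp [legendreFlux]
  | succ N ih =>
    rw [Finset.sum_range_succ, Finset.sum_range_succ, mul_add, ih]
    linear_combination -greenCoeff c N * legendreFlux_succ_sub N t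

lemma exists_summable_bound_flux {c : ℝ} (hc : 0 < c) :
    ∃ w : ℕ → ℝ, Summable w ∧ ∀ l, ∀ t ∈ Set.Icc (-1 : ℝ) 1,
      ‖(greenCoeff c l - greenCoeff c (l + 1)) * legendreFlux (l + 1) t‖ ≤ w l := by
  obtain ⟨K, hK, hle⟩ := exists_greenCoeff_le hc
  refine ⟨fun l => 4 * K ^ 2 * (1 / ((l : ℝ) + 1) ^ 2), summable_inv_succ_sq.mul_left _,
    fun l t ht => ?_⟩
  have h1 := abs_legendreFlux_le (l + 1) ht
  push_cast at h1
  have h3 := (greenCoeff_pos hc l).le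
  have h4 := (greenCoeff_pos hc (l + 1)).le
  have h5 : greenCoeff c (l + 1) ≤ K / ((l : ℝ) + 1) ^ 2 := by
    refine (hle (l + 1)).trans ?_
    push_cast
    gcongr
    linarith
  have h6 : greenCoeff c l * greenCoeff c (l + 1) ≤
      K / ((l : ℝ) + 1) ^ 2 * (K / ((l : ℝ) + 1) ^ 2) :=
    mul_le_mul (hle l) h5 h4 (by positivity)
  rw [greenCoeff_sub_succ hc, Real.norm_eq_abs, abs_mul, abs_of_nonneg (by positivity)]
  calc 2 * ((l : ℝ) + 1) * (greenCoeff c l * greenCoeff c (l + 1)) * |legendreFlux (l + 1) t|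
      ≤ 2 * ((l : ℝ) + 1) * (K / ((l : ℝ) + 1) ^ 2 * (K / ((l : ℝ) + 1) ^ 2)) *
        (2 * ((l : ℝ) + 1)) := by gcongr
    _ = 4 * K ^ 2 * (1 / ((l : ℝ) + 1) ^ 2) := by field_simp; ring

lemma tendsto_greenCoeff_mul_legendreFlux {c : ℝ} (hc : 0 < c) {t : ℝ}
    (ht : t ∈ Set.Icc (-1 : ℝ) 1) :
    Tendsto (fun N => greenCoeff c N * legendreFlux N t) atTop (𝓝 0) := by
  obtain ⟨K, hK, hle⟩ := exists_greenCoeff_le hc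
  have h0 : Tendsto (fun N : ℕ => 2 * K * (1 / ((N : ℝ) + 1))) atTop (𝓝 0) := by
    simpa using tendsto_one_div_add_atTop_nhds_zero_nat.const_mul (2 * K)
  refine squeeze_zero_norm (fun N => ?_) h0
  rw [Real.norm_eq_abs, abs_mul, abs_of_pos (greenCoeff_pos hc N)]
  calc greenCoeff c N * |legendreFlux N t|
      ≤ K / ((N : ℝ) + 1) ^ 2 * (2 * ((N : ℝ) + 1)) := by
        refine mul_le_mul (hle N) ?_ (abs_nonneg _) (by positivity)
        linarith [abs_legendreFlux_le N ht]
    _ = 2 * K * (1 / ((N : ℝ) + 1)) := by field_simp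

lemma summable_mul_greenCoeff_sq {c : ℝ} (hc : 0 < c) :
    Summable fun l : ℕ => (2 * (l : ℝ) + 1) * greenCoeff c l ^ 2 := by
  obtain ⟨K, hK, hle⟩ := exists_greenCoeff_le hc
  refine Summable.of_nonneg_of_le (fun l => by positivity) (fun l => ?_)
    (summable_inv_succ_sq.mul_left (2 * K ^ 2))
  have hl : (0 : ℝ) ≤ l := Nat.cast_nonneg l
  calc (2 * (l : ℝ) + 1) * greenCoeff c l ^ 2
      ≤ (2 * ((l : ℝ) + 1) ^ 2) * (K / ((l : ℝ) + 1) ^ 2) ^ 2 := by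
        refine mul_le_mul (by nlinarith) ?_ (sq_nonneg _) (by positivity)
        exact pow_le_pow_left₀ (greenCoeff_pos hc l).le (hle l) 2
    _ = 2 * K ^ 2 * (1 / ((l : ℝ) + 1) ^ 2) := by field_simp

lemma tendsto_sum_greenCoeff_atTop {c : ℝ} (hc : 0 < c) :
    Tendsto (fun N => ∑ l ∈ Finset.range N, (2 * (l : ℝ) + 1) * greenCoeff c l) atTop atTop := by
  have h := Real.tendsto_sum_range_one_div_nat_succ_atTop.const_mul_atTop
    (show 0 < 1 / (1 + c) by positivity)
  refine tendsto_atTop_mono (fun N => ?_) h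
  rw [Finset.mul_sum]
  refine Finset.sum_le_sum fun l _ => ?_
  have hl : (0 : ℝ) ≤ l := Nat.cast_nonneg l
  rw [greenCoeff, div_mul_div_comm, mul_one_div, div_le_div_iff₀ (by positivity) (by positivity)]
  nlinarith [mul_nonneg hl hl, mul_nonneg hc.le hl, mul_nonneg hc.le (mul_nonneg hl hl)]

end LegendreSeries

/-! ### The Green's function -/

section GreenFunction

/-- The Green's function, as the Legendre series after summation by parts: a continuous function of
the two points divided by `1 - cos γ`. On the diagonal the value is `0` by the convention for
division by zero. -/
noncomputable def greenFunction (R L : ℝ) (x y : Sph R) : ℝ :=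
  -(1 / (4 * Real.pi)) * ((∑' l,
    (greenCoeff (R ^ 2 / L ^ 2) l - greenCoeff (R ^ 2 / L ^ 2) (l + 1)) *
      legendreFlux (l + 1) (cosAngle x y)) / (1 - cosAngle x y))

lemma greenFunction_comm (R L : ℝ) (x y : Sph R) :
    greenFunction R L x y = greenFunction R L y x := by
  rw [greenFunction, greenFunction, cosAngle_comm]

lemma continuous_tsum_flux {R c : ℝ} (hc : 0 < c) :
    Continuous fun p : Sph R × Sph R => ∑' l, (greenCoeff c l - greenCoeff c (l + 1)) *
      legendreFlux (l + 1) (cosAngle p.1 p.2) := by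
  obtain ⟨w, hw, hle⟩ := exists_summable_bound_flux hc
  refine continuous_tsum (fun l => ?_) hw fun l p => hle l _ (cosAngle_mem_Icc _ _)
  unfold legendreFlux
  have h := fun k => (legendreP k).continuous.comp (continuous_cosAngle (R := R))
  exact continuous_const.mul (continuous_const.mul ((h _).sub (h _)))

lemma measurable_greenFunction {R L : ℝ} (hR : 0 < R) (hL : 0 < L) :
    Measurable fun p : Sph R × Sph R => greenFunction R L p.1 p.2 :=
  ((continuous_tsum_flux (R := R) (by positivity : 0 < R ^ 2 / L ^ 2)).measurable.div
    (measurable_const.sub continuous_cosAngle.measurable)).const_mul _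

lemma continuousOn_greenFunction {R L : ℝ} (hR : 0 < R) (hL : 0 < L) (y : Sph R) :
    ContinuousOn (fun x => greenFunction R L x y) {y}ᶜ := by
  have h1 : Continuous fun x : Sph R => (x, y) := Continuous.prodMk_left y
  refine continuousOn_const.mul (ContinuousOn.div
    ((continuous_tsum_flux (by positivity)).comp h1).continuousOn
    (continuous_const.sub (continuous_cosAngle.comp h1)).continuousOn fun x hx => ?_)
  exact (sub_pos.2 (cosAngle_lt_one hR hx)).ne'

lemma greenPartialSum_eq (R L : ℝ) (N : ℕ) (x y : Sph R) :
    greenPartialSum R L N x y = -(1 / (4 * Real.pi)) * ∑ l ∈ Finset.range N,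
      (2 * (l : ℝ) + 1) * greenCoeff (R ^ 2 / L ^ 2) l * (legendreP l).eval (cosAngle x y) := by
  simp only [greenPartialSum, cos_centralAngle, greenCoeff, mul_one_div]

lemma greenPartialSum_eq_zonal (R L : ℝ) (N : ℕ) (x y : Sph R) :
    greenPartialSum R L N x y = ∑ l ∈ Finset.range N,
      -(1 / (4 * Real.pi)) * ((2 * (l : ℝ) + 1) * greenCoeff (R ^ 2 / L ^ 2) l) * zonal l y x := by
  rw [greenPartialSum_eq, Finset.mul_sum]
  refine Finset.sum_congr rfl fun l _ => ?_
  rw [zonal, cosAngle_comm y x]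
  ring

lemma tendsto_greenPartialSum {R L : ℝ} (hR : 0 < R) (hL : 0 < L) {x y : Sph R} (h : x ≠ y) :
    Tendsto (fun N => greenPartialSum R L N x y) atTop (𝓝 (greenFunction R L x y)) := by
  have hc : 0 < R ^ 2 / L ^ 2 := by positivity
  set t := cosAngle x y with ht
  have ht1 : 1 - t ≠ 0 := (sub_pos.2 (cosAngle_lt_one hR h)).ne'
  have htm : t ∈ Set.Icc (-1 : ℝ) 1 := cosAngle_mem_Icc x y
  obtain ⟨w, hw, hle⟩ := exists_summable_bound_flux hc
  have hsum := (Summable.of_norm_bounded hw fun l => hle l t htm).hasSum.tendsto_sum_nat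
  have hlim := ((tendsto_greenCoeff_mul_legendreFlux hc htm).add hsum).div_const (1 - t)
  rw [zero_add] at hlim
  refine (hlim.const_mul (-(1 / (4 * Real.pi)))).congr fun N => ?_
  rw [greenPartialSum_eq, ← one_sub_mul_sum_greenCoeff, mul_div_cancel_left₀ _ ht1]

lemma tendsto_greenPartialSum_self {R L : ℝ} (hR : 0 < R) (hL : 0 < L) (x : Sph R) :
    Tendsto (fun N => greenPartialSum R L N x x) atTop atBot := by
  have h := (tendsto_sum_greenCoeff_atTop
    (c := R ^ 2 / L ^ 2) (by positivity)).const_mul_atTop_of_neg (r := -(1 / (4 * Real.pi)))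
      (neg_neg_of_pos (by positivity))
  refine h.congr fun N => ?_
  rw [greenPartialSum_eq]
  simp only [cosAngle_self hR, legendreP_eval_one, mul_one]

lemma continuous_greenPartialSum (R L : ℝ) (N : ℕ) (y : Sph R) :
    Continuous fun x => greenPartialSum R L N x y := by
  simp_rw [greenPartialSum_eq_zonal]
  exact continuous_finsetSum _ fun l _ => continuous_const.mul (continuous_zonal_right l y)

lemma integral_sum_zonal_sq {R : ℝ} (hR : 0 < R) (s : Finset ℕ) (w : ℕ → ℝ) (y : Sph R) :
    ∫ x, (∑ l ∈ s, w l * zonal l y x) ^ 2 ∂(surfaceMeasure R) =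
      ∑ l ∈ s, w l ^ 2 * (4 * Real.pi * R ^ 2 / (2 * l + 1)) := by
  have e : ∀ x, (∑ l ∈ s, w l * zonal l y x) ^ 2 =
      ∑ k ∈ s, ∑ l ∈ s, w k * w l * (zonal k y x * zonal l y x) := by
    intro x
    rw [sq, Finset.sum_mul_sum]
    exact Finset.sum_congr rfl fun k _ => Finset.sum_congr rfl fun l _ => by ring
  have hint : ∀ k l, Integrable (fun x => w k * w l * (zonal k y x * zonal l y x))
      (surfaceMeasure R) := fun k l =>
    (continuous_const.mul ((continuous_zonal_right k y).mul
      (continuous_zonal_right l y))).integrable_surfaceMeasure hR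
  simp_rw [e]
  rw [integral_finsetSum _ fun k _ => integrable_finsetSum _ fun l _ => hint k l]
  refine Finset.sum_congr rfl fun k hk => ?_
  rw [integral_finsetSum _ fun l _ => hint k l, Finset.sum_eq_single_of_mem k hk]
  · rw [integral_const_mul, integral_zonal_mul_zonal_self hR, zonal, cosAngle_self hR,
      legendreP_eval_one]
    ring
  · intro l _ hl
    rw [integral_const_mul, integral_zonal_mul_zonal_of_ne hR hl.symm, mul_zero]

/-- The tail `R² / 4π ∑_{l ≥ N} (2l + 1) / (l (l + 1) + R² / L²)²`, which bounds the squared `L²`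
distance of the Green's function to its `N`-th partial sum. -/
noncomputable def greenTail (R L : ℝ) (N : ℕ) : ℝ :=
  R ^ 2 / (4 * Real.pi) * ∑' l : ℕ, (2 * ((l + N : ℕ) : ℝ) + 1) *
    greenCoeff (R ^ 2 / L ^ 2) (l + N) ^ 2

lemma summable_greenTail {R L : ℝ} (hR : 0 < R) (hL : 0 < L) (N : ℕ) :
    Summable fun l : ℕ => (2 * ((l + N : ℕ) : ℝ) + 1) *
      greenCoeff (R ^ 2 / L ^ 2) (l + N) ^ 2 :=
  (summable_nat_add_iff (f := fun l : ℕ => (2 * (l : ℝ) + 1) *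
    greenCoeff (R ^ 2 / L ^ 2) l ^ 2) N).2 (summable_mul_greenCoeff_sq (by positivity))

lemma tendsto_greenTail (R L : ℝ) : Tendsto (greenTail R L) atTop (𝓝 0) := by
  have h := tendsto_sum_nat_add fun l : ℕ => (2 * (l : ℝ) + 1) *
    greenCoeff (R ^ 2 / L ^ 2) l ^ 2
  have h2 := h.const_mul (R ^ 2 / (4 * Real.pi))
  rw [mul_zero] at h2
  exact h2

lemma greenTail_pos {R L : ℝ} (hR : 0 < R) (hL : 0 < L) (N : ℕ) : 0 < greenTail R L N := by
  have hc : 0 < R ^ 2 / L ^ 2 := by positivity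
  have hp : ∀ l : ℕ, 0 < (2 * ((l + N : ℕ) : ℝ) + 1) * greenCoeff (R ^ 2 / L ^ 2) (l + N) ^ 2 :=
    fun l => mul_pos (by positivity) (pow_pos (greenCoeff_pos hc _) 2)
  exact mul_pos (by positivity)
    ((summable_greenTail hR hL N).tsum_pos (fun l => (hp l).le) 0 (hp 0))

lemma integral_greenPartialSum_sub_sq_le {R L : ℝ} (hR : 0 < R) (hL : 0 < L) (N m : ℕ)
    (y : Sph R) :
    ∫ x, (greenPartialSum R L (m + N) x y - greenPartialSum R L N x y) ^ 2 ∂(surfaceMeasure R) ≤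
      greenTail R L N := by
  have e : ∀ x, greenPartialSum R L (m + N) x y - greenPartialSum R L N x y =
      ∑ l ∈ Finset.Ico N (m + N),
        -(1 / (4 * Real.pi)) * ((2 * (l : ℝ) + 1) * greenCoeff (R ^ 2 / L ^ 2) l) *
          zonal l y x := by
    intro x
    rw [greenPartialSum_eq_zonal, greenPartialSum_eq_zonal,
      Finset.sum_Ico_eq_sub _ (Nat.le_add_left N m)]
  simp_rw [e]
  rw [integral_sum_zonal_sq hR]
  have e2 : ∀ l : ℕ, (-(1 / (4 * Real.pi)) * ((2 * (l : ℝ) + 1) *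
      greenCoeff (R ^ 2 / L ^ 2) l)) ^ 2 * (4 * Real.pi * R ^ 2 / (2 * l + 1)) =
      R ^ 2 / (4 * Real.pi) * ((2 * (l : ℝ) + 1) * greenCoeff (R ^ 2 / L ^ 2) l ^ 2) := by
    intro l
    have : 2 * (l : ℝ) + 1 ≠ 0 := by positivity
    have := Real.pi_ne_zero
    field_simp
  simp_rw [e2]
  rw [← Finset.mul_sum, Finset.sum_Ico_eq_sum_range, Nat.add_sub_cancel, greenTail]
  refine mul_le_mul_of_nonneg_left ?_ (by positivity)
  have := (summable_greenTail hR hL N).sum_le_tsum (Finset.range m) fun l _ => by positivity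
  refine le_trans (le_of_eq (Finset.sum_congr rfl fun l _ => ?_)) this
  rw [add_comm N l]

lemma ae_ne_surfaceMeasure {R : ℝ} (hR : 0 < R) (y : Sph R) : ∀ᵐ x ∂(surfaceMeasure R), x ≠ y := by
  have := nullSingletonClass_surfaceMeasure hR
  exact compl_mem_ae_iff.2 (measure_singleton y)

lemma measurable_greenFunction_left {R L : ℝ} (hR : 0 < R) (hL : 0 < L) (y : Sph R) :
    Measurable fun x => greenFunction R L x y :=
  Measurable.of_uncurry_right (f := greenFunction R L) (measurable_greenFunction hR hL)

/-- The partial sums converge to the Green's function in `L²`, by orthogonality of the zonal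
harmonics and Fatou's lemma. -/
lemma lintegral_greenFunction_sub_sq_le {R L : ℝ} (hR : 0 < R) (hL : 0 < L) (N : ℕ) (y : Sph R) :
    ∫⁻ x, ENNReal.ofReal ((greenFunction R L x y - greenPartialSum R L N x y) ^ 2)
      ∂(surfaceMeasure R) ≤ ENNReal.ofReal (greenTail R L N) := by
  have hlim : ∀ᵐ x ∂(surfaceMeasure R),
      ENNReal.ofReal ((greenFunction R L x y - greenPartialSum R L N x y) ^ 2) =
        liminf (fun m => ENNReal.ofReal
          ((greenPartialSum R L (m + N) x y - greenPartialSum R L N x y) ^ 2)) atTop := by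
    filter_upwards [ae_ne_surfaceMeasure hR y] with x hx
    refine (Tendsto.liminf_eq ?_).symm
    refine ENNReal.tendsto_ofReal (Tendsto.pow (Tendsto.sub_const ?_ _) 2)
    exact (tendsto_add_atTop_iff_nat N).2 (tendsto_greenPartialSum hR hL hx)
  have hcont : ∀ m, Continuous fun x =>
      (greenPartialSum R L (m + N) x y - greenPartialSum R L N x y) ^ 2 := fun m =>
    ((continuous_greenPartialSum R L _ y).sub (continuous_greenPartialSum R L _ y)).pow 2
  rw [lintegral_congr_ae hlim]
  refine (lintegral_liminf_le fun m => (hcont m).measurable.ennreal_ofReal).trans ?_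
  refine liminf_le_of_le (by isBoundedDefault) fun b hb => ?_
  obtain ⟨m, hm⟩ := hb.exists
  refine hm.trans ?_
  rw [← ofReal_integral_eq_lintegral_ofReal ((hcont m).integrable_surfaceMeasure hR)
    (Eventually.of_forall fun x => sq_nonneg _)]
  exact ENNReal.ofReal_le_ofReal (integral_greenPartialSum_sub_sq_le hR hL N m y)

lemma integrable_greenFunction_sub_sq {R L : ℝ} (hR : 0 < R) (hL : 0 < L) (N : ℕ) (y : Sph R) :
    Integrable (fun x => (greenFunction R L x y - greenPartialSum R L N x y) ^ 2)
      (surfaceMeasure R) := by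
  refine ⟨(((measurable_greenFunction_left hR hL y).sub
    (continuous_greenPartialSum R L N y).measurable).pow_const 2).aestronglyMeasurable, ?_⟩
  rw [hasFiniteIntegral_iff_ofReal (Eventually.of_forall fun x => sq_nonneg _)]
  exact (lintegral_greenFunction_sub_sq_le hR hL N y).trans_lt ENNReal.ofReal_lt_top

lemma integral_greenFunction_sub_sq_le {R L : ℝ} (hR : 0 < R) (hL : 0 < L) (N : ℕ) (y : Sph R) :
    ∫ x, (greenFunction R L x y - greenPartialSum R L N x y) ^ 2 ∂(surfaceMeasure R) ≤
      greenTail R L N := by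
  rw [integral_eq_lintegral_of_nonneg_ae (Eventually.of_forall fun x => sq_nonneg _)
    (integrable_greenFunction_sub_sq hR hL N y).aestronglyMeasurable]
  exact ENNReal.toReal_le_of_le_ofReal (greenTail_pos hR hL N).le
    (lintegral_greenFunction_sub_sq_le hR hL N y)

lemma memLp_greenFunction_sub {R L : ℝ} (hR : 0 < R) (hL : 0 < L) (N : ℕ) (y : Sph R) :
    MemLp (fun x => greenFunction R L x y - greenPartialSum R L N x y) 2 (surfaceMeasure R) :=
  (memLp_two_iff_integrable_sq ((measurable_greenFunction_left hR hL y).sub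
    (continuous_greenPartialSum R L N y).measurable).aestronglyMeasurable).2
      (integrable_greenFunction_sub_sq hR hL N y)

lemma memLp_greenFunction {R L : ℝ} (hR : 0 < R) (hL : 0 < L) (y : Sph R) :
    MemLp (fun x => greenFunction R L x y) 2 (surfaceMeasure R) := by
  simpa [greenPartialSum] using memLp_greenFunction_sub hR hL 0 y

lemma integrable_greenFunction_sq {R L : ℝ} (hR : 0 < R) (hL : 0 < L) (y : Sph R) :
    Integrable (fun x => greenFunction R L x y ^ 2) (surfaceMeasure R) := by
  simpa [greenPartialSum] using integrable_greenFunction_sub_sq hR hL 0 y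

lemma integral_greenFunction_sq_le {R L : ℝ} (hR : 0 < R) (hL : 0 < L) (y : Sph R) :
    ∫ x, greenFunction R L x y ^ 2 ∂(surfaceMeasure R) ≤ greenTail R L 0 := by
  simpa [greenPartialSum] using integral_greenFunction_sub_sq_le hR hL 0 y

lemma integrable_greenFunction {R L : ℝ} (hR : 0 < R) (hL : 0 < L) (y : Sph R) :
    Integrable (fun x => greenFunction R L x y) (surfaceMeasure R) := by
  have := isFiniteMeasure_surfaceMeasure hR
  exact (memLp_greenFunction hR hL y).integrable one_le_two

lemma MeasureTheory.Integrable.mul_continuous_surfaceMeasure {R : ℝ} {F h : Sph R → ℝ}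
    (hF : Integrable F (surfaceMeasure R)) (hh : Continuous h) :
    Integrable (fun x => F x * h x) (surfaceMeasure R) := by
  obtain ⟨B, hB⟩ := isCompact_univ.exists_bound_of_continuousOn hh.continuousOn
  exact hF.mul_bdd hh.aestronglyMeasurable (Eventually.of_forall fun x => hB x (Set.mem_univ x))

lemma tendsto_integral_greenPartialSum_mul {R L : ℝ} (hR : 0 < R) (hL : 0 < L) (y : Sph R)
    {h : Sph R → ℝ} (hh : Continuous h) :
    Tendsto (fun N => ∫ x, greenPartialSum R L N x y * h x ∂(surfaceMeasure R)) atTop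
      (𝓝 (∫ x, greenFunction R L x y * h x ∂(surfaceMeasure R))) := by
  set H := ∫ x, h x ^ 2 ∂(surfaceMeasure R) with hH
  have hsqrt : Tendsto (fun N => √(greenTail R L N) * (1 + H)) atTop (𝓝 0) := by
    simpa using (tendsto_greenTail R L).sqrt.mul_const (1 + H)
  have hint : ∀ N, Integrable (fun x => (greenFunction R L x y - greenPartialSum R L N x y) * h x)
      (surfaceMeasure R) := fun N =>
    ((integrable_greenFunction hR hL y).sub
      ((continuous_greenPartialSum R L N y).integrable_surfaceMeasure
        hR)).mul_continuous_surfaceMeasure hh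
  rw [tendsto_iff_norm_sub_tendsto_zero]
  refine squeeze_zero (fun N => norm_nonneg _) (fun N => ?_) hsqrt
  have e : ∫ x, greenPartialSum R L N x y * h x ∂(surfaceMeasure R) -
      ∫ x, greenFunction R L x y * h x ∂(surfaceMeasure R) =
      -∫ x, (greenFunction R L x y - greenPartialSum R L N x y) * h x ∂(surfaceMeasure R) := by
    rw [← integral_sub
      (((continuous_greenPartialSum R L N y).integrable_surfaceMeasure
        hR).mul_continuous_surfaceMeasure hh)
      ((integrable_greenFunction hR hL y).mul_continuous_surfaceMeasure hh), ← integral_neg]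
    congr 1
    funext x
    ring
  set s := √(greenTail R L N) with hs
  have hs0 : 0 < s := Real.sqrt_pos.2 (greenTail_pos hR hL N)
  have hss : s * s = greenTail R L N := Real.mul_self_sqrt (greenTail_pos hR hL N).le
  have hsq := (integrable_greenFunction_sub_sq hR hL N y).const_mul (1 / s)
  have hhq : Integrable (fun x => s * h x ^ 2) (surfaceMeasure R) :=
    ((hh.pow 2).integrable_surfaceMeasure hR).const_mul s
  rw [e, norm_neg]
  refine (norm_integral_le_integral_norm _).trans ?_
  -- `|f h| ≤ f² / s + s h²`, with `s²` the bound on `∫ f²` so that both terms are of order `s`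
  calc ∫ x, ‖(greenFunction R L x y - greenPartialSum R L N x y) * h x‖ ∂(surfaceMeasure R)
      ≤ ∫ x, (1 / s * (greenFunction R L x y - greenPartialSum R L N x y) ^ 2 + s * h x ^ 2)
          ∂(surfaceMeasure R) := by
        refine integral_mono (hint N).norm (hsq.add hhq) fun x => ?_
        set f := greenFunction R L x y - greenPartialSum R L N x y
        change ‖f * h x‖ ≤ 1 / s * f ^ 2 + s * h x ^ 2
        rw [Real.norm_eq_abs, abs_mul, ← sq_abs f, ← sq_abs (h x), ← sub_nonneg]
        have : 1 / s * |f| ^ 2 + s * |h x| ^ 2 - |f| * |h x| =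
            1 / s * ((|f| - s * |h x|) ^ 2 + |f| * (s * |h x|)) := by
          field_simp
          ring
        rw [this]
        positivity
    _ = 1 / s * ∫ x, (greenFunction R L x y - greenPartialSum R L N x y) ^ 2 ∂(surfaceMeasure R) +
          s * H := by
        rw [integral_add hsq hhq, integral_const_mul, integral_const_mul]
    _ ≤ 1 / s * (s * s) + s * H := by
        rw [hss]
        gcongr
        exact integral_greenFunction_sub_sq_le hR hL N y
    _ = s * (1 + H) := by
        field_simp

lemma integral_greenFunction_mul_zonal {R L : ℝ} (hR : 0 < R) (hL : 0 < L) (l : ℕ)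
    (y z : Sph R) :
    ∫ x, greenFunction R L x y * zonal l z x ∂(surfaceMeasure R) =
      -(R ^ 2 * greenCoeff (R ^ 2 / L ^ 2) l) * zonal l z y := by
  refine tendsto_nhds_unique (tendsto_integral_greenPartialSum_mul hR hL y
    (continuous_zonal_right l z)) (tendsto_const_nhds.congr' ?_)
  filter_upwards [eventually_gt_atTop l] with N hN
  simp_rw [greenPartialSum_eq_zonal, Finset.sum_mul, mul_assoc _ (zonal _ y _)]
  have hint : ∀ k, Integrable (fun x => zonal k y x * zonal l z x) (surfaceMeasure R) := fun k =>
    ((continuous_zonal_right k y).mul (continuous_zonal_right l z)).integrable_surfaceMeasure hR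
  rw [integral_finsetSum _ fun k _ => (hint k).const_mul _,
    Finset.sum_eq_single_of_mem l (Finset.mem_range.2 hN)]
  · rw [integral_const_mul, integral_zonal_mul_zonal_self hR]
    have : 2 * (l : ℝ) + 1 ≠ 0 := by positivity
    have := Real.pi_ne_zero
    field_simp
  · intro k _ hk
    rw [integral_const_mul, integral_zonal_mul_zonal_of_ne hR hk, mul_zero]

end GreenFunction

/-! ### The Green's representation formula -/

section Representation

/-- Continuous right-hand sides `h` for which the screened Poisson equation has a smooth solution
that is represented by the Green's function. -/
noncomputable def solvableSubmodule {R L : ℝ} (hR : 0 < R) (hL : 0 < L) :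
    Submodule ℝ C(Sph R, ℝ) where
  carrier := {h | ∃ v : Sph R → ℝ, SphereContDiff R ∞ v ∧
    (∀ x, laplaceBeltrami R v x - v x / L ^ 2 = h x) ∧
    ∀ y, ∫ x, greenFunction R L x y * h x ∂(surfaceMeasure R) = v y}
  zero_mem' := by
    have h0 : radialExtension R 0 = 0 := by
      simpa using radialExtension_const_smul R 0 0
    refine ⟨0, ?_, fun x => ?_, fun y => by simp⟩
    · rw [SphereContDiff, h0]
      exact contDiffOn_const
    · have h1 : Laplacian.laplacian (0 : E3 → ℝ) = 0 := InnerProductSpace.laplacian_const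
      simp [laplaceBeltrami, h0, h1]
  add_mem' := by
    rintro h h' ⟨v, hv, hvh, hvG⟩ ⟨v', hv', hvh', hvG'⟩
    refine ⟨v + v', hv.add hv', fun x => ?_, fun y => ?_⟩
    · rw [laplaceBeltrami_add hR (hv.of_le two_le_smooth) (hv'.of_le two_le_smooth),
        ContinuousMap.add_apply, ← hvh, ← hvh', Pi.add_apply]
      ring
    · simp only [ContinuousMap.add_apply, mul_add, Pi.add_apply]
      rw [integral_add
        ((integrable_greenFunction hR hL y).mul_continuous_surfaceMeasure h.continuous)
        ((integrable_greenFunction hR hL y).mul_continuous_surfaceMeasure h'.continuous), hvG, hvG']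
  smul_mem' := by
    rintro a h ⟨v, hv, hvh, hvG⟩
    refine ⟨a • v, hv.const_smul a, fun x => ?_, fun y => ?_⟩
    · rw [laplaceBeltrami_const_smul hR (hv.of_le two_le_smooth), ContinuousMap.smul_apply, ← hvh,
        Pi.smul_apply, smul_eq_mul, smul_eq_mul]
      ring
    · simp only [ContinuousMap.smul_apply, smul_eq_mul, Pi.smul_apply, mul_left_comm _ a]
      rw [integral_const_mul, hvG]

/-- Zonal harmonics are eigenfunctions, so each is a solvable right-hand side. -/
lemma zonalSpan_le_solvableSubmodule {R L : ℝ} (hR : 0 < R) (hL : 0 < L) :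
    zonalSpan R ≤ solvableSubmodule hR hL := by
  refine Submodule.span_le.2 ?_
  rintro _ ⟨⟨l, z⟩, rfl⟩
  refine ⟨(-(R ^ 2 * greenCoeff (R ^ 2 / L ^ 2) l)) • zonal l z,
    (sphereContDiff_zonal hR l z).const_smul _, fun x => ?_, fun y => ?_⟩
  · have hne : (l : ℝ) * (l + 1) + R ^ 2 / L ^ 2 ≠ 0 := by positivity
    rw [laplaceBeltrami_const_smul hR ((sphereContDiff_zonal hR l z).of_le two_le_smooth),
      laplaceBeltrami_zonal hR, Pi.smul_apply, smul_eq_mul, greenCoeff]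
    simp only [ContinuousMap.coe_mk]
    field_simp
    ring
  · exact integral_greenFunction_mul_zonal hR hL l y z

/-- Solvable right-hand sides are uniformly dense. -/
lemma exists_solvable_near {R L : ℝ} (hR : 0 < R) (hL : 0 < L) {h : Sph R → ℝ}
    (hh : Continuous h) {ε : ℝ} (hε : 0 < ε) :
    ∃ h' v : Sph R → ℝ, Continuous h' ∧ (∀ x, |h x - h' x| ≤ ε) ∧ SphereContDiff R ∞ v ∧
      (∀ x, laplaceBeltrami R v x - v x / L ^ 2 = h' x) ∧
      ∀ y, ∫ x, greenFunction R L x y * h' x ∂(surfaceMeasure R) = v y := by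
  have hmem : (⟨h, hh⟩ : C(Sph R, ℝ)) ∈ (zonalSpan R).topologicalClosure := by
    rw [topologicalClosure_zonalSpan hR]
    trivial
  obtain ⟨h', hh', hd⟩ := Metric.mem_closure_iff.1 hmem ε hε
  obtain ⟨v, hv, hvh, hvG⟩ := zonalSpan_le_solvableSubmodule hR hL hh'
  refine ⟨h', v, h'.continuous, fun x => ?_, hv, hvh, hvG⟩
  exact (ContinuousMap.dist_apply_le_dist (f := ⟨h, hh⟩) (g := h') x).trans hd.le

/-- The Green's representation of a `C²` function. Its right-hand side is approximated uniformly by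
solvable ones; the corresponding solutions converge uniformly by the maximum principle. -/
theorem integral_greenFunction_mul_screened {R L : ℝ} (hR : 0 < R) (hL : 0 < L) {v : Sph R → ℝ}
    (hv : SphereContDiff R 2 v) (y : Sph R) :
    ∫ x, greenFunction R L x y * (laplaceBeltrami R v x - v x / L ^ 2) ∂(surfaceMeasure R) =
      v y := by
  set h : Sph R → ℝ := fun x => laplaceBeltrami R v x - v x / L ^ 2 with hdef
  have hh : Continuous h :=
    (continuous_laplaceBeltrami hR hv).sub ((hv.continuous hR).div_const _)
  have hG := integrable_greenFunction hR hL y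
  set A := ∫ x, |greenFunction R L x y| ∂(surfaceMeasure R) with hA
  have hA0 : 0 ≤ A := integral_nonneg fun x => abs_nonneg _
  have key : ∀ ε > 0, |∫ x, greenFunction R L x y * h x ∂(surfaceMeasure R) - v y| ≤
      ε * (A + L ^ 2) := by
    intro ε hε
    obtain ⟨h', v', hh', hd, hv', hvh', hvG'⟩ := exists_solvable_near hR hL hh hε
    have hv2 := hv'.of_le two_le_smooth
    have h1 : |v' y - v y| ≤ ε * L ^ 2 := by
      have := abs_le_of_abs_screened_le (ε := ε) hR hL (hv2.add (hv.const_smul (-1)))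
        (fun x => ?_) y
      · simpa [sub_eq_add_neg] using this
      · rw [laplaceBeltrami_add hR hv2 (hv.const_smul (-1)), laplaceBeltrami_const_smul hR hv]
        have e : laplaceBeltrami R v' x + -1 * laplaceBeltrami R v x -
            (v' + (-1 : ℝ) • v) x / L ^ 2 = -(h x - h' x) := by
          rw [← hvh', hdef]
          simp only [Pi.add_apply, Pi.smul_apply, smul_eq_mul]
          ring
        rw [e, abs_neg]
        exact hd x
    have h2 : |∫ x, greenFunction R L x y * h x ∂(surfaceMeasure R) - v' y| ≤ ε * A := by
      rw [← hvG', ← integral_sub (hG.mul_continuous_surfaceMeasure hh)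
        (hG.mul_continuous_surfaceMeasure hh')]
      refine abs_integral_le_integral_abs.trans ?_
      rw [hA, ← integral_const_mul]
      refine integral_mono ((hG.mul_continuous_surfaceMeasure hh).sub
        (hG.mul_continuous_surfaceMeasure hh')).abs (hG.abs.const_mul ε) fun x => ?_
      change |greenFunction R L x y * h x - greenFunction R L x y * h' x| ≤ _
      rw [← mul_sub, abs_mul, mul_comm]
      exact mul_le_mul_of_nonneg_right (hd x) (abs_nonneg _)
    calc _ ≤ _ := abs_sub_le _ (v' y) _
      _ ≤ ε * A + ε * L ^ 2 := add_le_add h2 h1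
      _ = ε * (A + L ^ 2) := by ring
  have hpos : 0 < A + L ^ 2 := by positivity
  have : |∫ x, greenFunction R L x y * h x ∂(surfaceMeasure R) - v y| ≤ 0 := by
    refine le_of_forall_pos_le_add fun δ hδ => ?_
    refine (key (δ / (A + L ^ 2)) (by positivity)).trans ?_
    rw [div_mul_cancel₀ _ hpos.ne', zero_add]
  exact sub_eq_zero.1 (abs_eq_zero.1 (le_antisymm this (abs_nonneg _)))

end Representation

/-! ### Uniqueness -/

section Uniqueness

lemma ae_eq_zero_of_forall_integral_mul_continuous {R : ℝ} (hR : 0 < R) {F : Sph R → ℝ}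
    (hF : Integrable F (surfaceMeasure R))
    (h : ∀ g : Sph R → ℝ, Continuous g → ∫ x, F x * g x ∂(surfaceMeasure R) = 0) :
    F =ᵐ[surfaceMeasure R] 0 := by
  have := isFiniteMeasure_surfaceMeasure hR
  refine ae_eq_zero_of_forall_setIntegral_isClosed_eq_zero hF fun s hs => ?_
  have hlim : Tendsto (fun n => ∫ x, F x * (hs.apprSeq n x : ℝ) ∂(surfaceMeasure R)) atTop
      (𝓝 (∫ x, s.indicator F x ∂(surfaceMeasure R))) := by
    refine tendsto_integral_of_dominated_convergence (fun x => ‖F x‖) (fun n => ?_) hF.norm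
      (fun n => Eventually.of_forall fun x => ?_) (Eventually.of_forall fun x => ?_)
    · exact (hF.mul_continuous_surfaceMeasure (by fun_prop)).aestronglyMeasurable
    · rw [norm_mul]
      refine mul_le_of_le_one_right (norm_nonneg _) ?_
      simpa using HasOuterApproxClosed.apprSeq_apply_le_one hs n x
    · have h1 := tendsto_pi_nhds.1 (HasOuterApproxClosed.tendsto_apprSeq hs) x
      have h2 := ((NNReal.continuous_coe.tendsto _).comp h1).const_mul (F x)
      by_cases hx : x ∈ s
      · simpa [hx] using h2
      · simpa [hx] using h2
  rw [← integral_indicator hs.measurableSet]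
  refine tendsto_nhds_unique hlim (tendsto_const_nhds.congr fun n => ?_)
  exact (h _ (by fun_prop)).symm

/-- An integrable function orthogonal to the range of the screened Laplacian vanishes, since that
range is uniformly dense. -/
lemma ae_eq_zero_of_forall_integral_mul_screened {R L : ℝ} (hR : 0 < R) (hL : 0 < L)
    {F : Sph R → ℝ} (hF : Integrable F (surfaceMeasure R))
    (h : ∀ v : Sph R → ℝ, SphereContDiff R ∞ v →
      ∫ x, F x * (laplaceBeltrami R v x - v x / L ^ 2) ∂(surfaceMeasure R) = 0) :
    F =ᵐ[surfaceMeasure R] 0 := by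
  refine ae_eq_zero_of_forall_integral_mul_continuous hR hF fun g hg => ?_
  set A := ∫ x, |F x| ∂(surfaceMeasure R) with hA
  have hA0 : 0 ≤ A := integral_nonneg fun x => abs_nonneg _
  have key : ∀ ε > 0, |∫ x, F x * g x ∂(surfaceMeasure R)| ≤ ε * A := by
    intro ε hε
    obtain ⟨h', v', hh', hd, hv', hvh', -⟩ := exists_solvable_near hR hL hg hε
    have h0 := h v' hv'
    simp_rw [hvh'] at h0
    rw [← sub_zero (∫ x, F x * g x ∂(surfaceMeasure R)), ← h0,
      ← integral_sub (hF.mul_continuous_surfaceMeasure hg) (hF.mul_continuous_surfaceMeasure hh')]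
    refine abs_integral_le_integral_abs.trans ?_
    rw [hA, ← integral_const_mul]
    refine integral_mono ((hF.mul_continuous_surfaceMeasure hg).sub
      (hF.mul_continuous_surfaceMeasure hh')).abs (hF.abs.const_mul ε) fun x => ?_
    change |F x * g x - F x * h' x| ≤ _
    rw [← mul_sub, abs_mul, mul_comm]
    exact mul_le_mul_of_nonneg_right (hd x) (abs_nonneg _)
  have : |∫ x, F x * g x ∂(surfaceMeasure R)| ≤ 0 := by
    refine le_of_forall_pos_le_add fun δ hδ => ?_
    refine (key (δ / (A + 1)) (by positivity)).trans ?_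
    rw [zero_add, div_mul_eq_mul_div, div_le_iff₀ (by positivity)]
    nlinarith
  exact abs_eq_zero.1 (le_antisymm this (abs_nonneg _))

lemma isGreenFunction_greenFunction {R L : ℝ} (hR : 0 < R) (hL : 0 < L) :
    IsGreenFunction R L (greenFunction R L) where
  continuousOn := continuousOn_greenFunction hR hL
  integrable := integrable_greenFunction hR hL
  delta y _ hv := integral_greenFunction_mul_screened hR hL (hv.of_le two_le_smooth) y

lemma IsGreenFunction.eq_off_diagonal {R L : ℝ} (hR : 0 < R) (hL : 0 < L)
    {G G' : Sph R → Sph R → ℝ} (hG : IsGreenFunction R L G) (hG' : IsGreenFunction R L G')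
    {x y : Sph R} (hxy : x ≠ y) : G' x y = G x y := by
  have := isOpenPosMeasure_surfaceMeasure hR
  have hsc : ∀ v : Sph R → ℝ, SphereContDiff R ∞ v →
      Continuous fun x => laplaceBeltrami R v x - v x / L ^ 2 := fun v hv =>
    (continuous_laplaceBeltrami hR (hv.of_le two_le_smooth)).sub ((hv.continuous hR).div_const _)
  have h := ae_eq_zero_of_forall_integral_mul_screened hR hL
    ((hG'.integrable y).sub (hG.integrable y)) fun v hv => by
      simp only [Pi.sub_apply, sub_mul]
      rw [integral_sub ((hG'.integrable y).mul_continuous_surfaceMeasure (hsc v hv))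
        ((hG.integrable y).mul_continuous_surfaceMeasure (hsc v hv)), hG'.delta y v hv,
        hG.delta y v hv, sub_self]
  have hae : (fun x => G' x y) =ᵐ[(surfaceMeasure R).restrict {y}ᶜ] fun x => G x y := by
    refine ae_restrict_of_ae ?_
    filter_upwards [h] with x hx
    exact sub_eq_zero.1 hx
  exact Measure.eqOn_open_of_ae_eq hae isOpen_compl_singleton (hG'.continuousOn y)
    (hG.continuousOn y) hxy

end Uniqueness

/-! ### Weak solutions -/

section WeakSolutions

lemma integrable_greenFunction_mul {R L : ℝ} (hR : 0 < R) (hL : 0 < L) {f : Sph R → ℝ}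
    (hf : MemLp f 2 (surfaceMeasure R)) (x : Sph R) :
    Integrable (fun y => greenFunction R L x y * f y) (surfaceMeasure R) := by
  simp_rw [greenFunction_comm R L x]
  exact (memLp_greenFunction hR hL x).integrable_mul hf

lemma integral_abs_greenFunction_mul_le {R L : ℝ} (hR : 0 < R) (hL : 0 < L) {f : Sph R → ℝ}
    (hf : MemLp f 2 (surfaceMeasure R)) (x : Sph R) :
    ∫ y, |greenFunction R L x y * f y| ∂(surfaceMeasure R) ≤
      greenTail R L 0 + ∫ y, f y ^ 2 ∂(surfaceMeasure R) := by
  have h1 := integrable_greenFunction_sq hR hL x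
  have h2 := (memLp_two_iff_integrable_sq hf.aestronglyMeasurable).1 hf
  simp_rw [greenFunction_comm R L _ x] at h1
  calc _ ≤ ∫ y, (greenFunction R L x y ^ 2 + f y ^ 2) ∂(surfaceMeasure R) := by
        refine integral_mono (integrable_greenFunction_mul hR hL hf x).abs (h1.add h2) fun y => ?_
        change |greenFunction R L x y * f y| ≤ greenFunction R L x y ^ 2 + f y ^ 2
        rw [abs_mul, ← sq_abs (greenFunction R L x y), ← sq_abs (f y)]
        nlinarith [sq_nonneg (|greenFunction R L x y| - |f y|), abs_nonneg (greenFunction R L x y),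
          abs_nonneg (f y), mul_nonneg (abs_nonneg (greenFunction R L x y)) (abs_nonneg (f y))]
    _ = ∫ y, greenFunction R L x y ^ 2 ∂(surfaceMeasure R) +
          ∫ y, f y ^ 2 ∂(surfaceMeasure R) := integral_add h1 h2
    _ ≤ _ := by
        gcongr
        simp_rw [greenFunction_comm R L x]
        exact integral_greenFunction_sq_le hR hL x

lemma aestronglyMeasurable_greenFunction_mul {R L : ℝ} (hR : 0 < R) (hL : 0 < L)
    {f : Sph R → ℝ} (hf : AEStronglyMeasurable f (surfaceMeasure R)) :
    AEStronglyMeasurable (fun p : Sph R × Sph R => greenFunction R L p.1 p.2 * f p.2)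
      ((surfaceMeasure R).prod (surfaceMeasure R)) := by
  have := isFiniteMeasure_surfaceMeasure hR
  exact (measurable_greenFunction hR hL).aestronglyMeasurable.mul hf.comp_snd

/-- The Green's potential of a square-integrable function is a weak solution: the order of
integration is exchanged by Fubini's theorem. -/
lemma isWeakSolution_greenPotential {R L : ℝ} (hR : 0 < R) (hL : 0 < L) {f : Sph R → ℝ}
    (hf : MemLp f 2 (surfaceMeasure R)) :
    IsWeakSolution R L f fun x => ∫ y, greenFunction R L x y * f y ∂(surfaceMeasure R) := by
  have := isFiniteMeasure_surfaceMeasure hR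
  have hm := aestronglyMeasurable_greenFunction_mul hR hL hf.aestronglyMeasurable
  set B := greenTail R L 0 + ∫ y, f y ^ 2 ∂(surfaceMeasure R) with hB
  have hbound : ∀ x, ∫ y, |greenFunction R L x y * f y| ∂(surfaceMeasure R) ≤ B :=
    integral_abs_greenFunction_mul_le hR hL hf
  refine ⟨MemLp.of_bound hm.integral_prod_right' B (Eventually.of_forall fun x =>
    (norm_integral_le_integral_norm _).trans (hbound x)), fun v hv => ?_⟩
  set h : Sph R → ℝ := fun x => laplaceBeltrami R v x - v x / L ^ 2 with hdef
  have hv2 := hv.of_le two_le_smooth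
  have hh : Continuous h :=
    (continuous_laplaceBeltrami hR hv2).sub ((hv.continuous hR).div_const _)
  obtain ⟨C, hC⟩ := isCompact_univ.exists_bound_of_continuousOn hh.continuousOn
  have hGf : Integrable (fun p : Sph R × Sph R => greenFunction R L p.1 p.2 * f p.2)
      ((surfaceMeasure R).prod (surfaceMeasure R)) := by
    refine (integrable_prod_iff hm).2 ⟨Eventually.of_forall fun x =>
      integrable_greenFunction_mul hR hL hf x, ?_⟩
    refine (integrable_const B).mono' hm.norm.integral_prod_right'
      (Eventually.of_forall fun x => ?_)
    rw [Real.norm_of_nonneg (integral_nonneg fun y => norm_nonneg _)]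
    exact hbound x
  have hprod : Integrable (Function.uncurry fun x y : Sph R => greenFunction R L x y * f y * h x)
      ((surfaceMeasure R).prod (surfaceMeasure R)) :=
    hGf.mul_bdd (hh.comp continuous_fst).aestronglyMeasurable
      (Eventually.of_forall fun p => hC p.1 (Set.mem_univ _))
  calc ∫ x, (∫ y, greenFunction R L x y * f y ∂(surfaceMeasure R)) * h x ∂(surfaceMeasure R)
      = ∫ x, ∫ y, greenFunction R L x y * f y * h x ∂(surfaceMeasure R) ∂(surfaceMeasure R) := by
        simp_rw [integral_mul_const]
    _ = ∫ y, ∫ x, greenFunction R L x y * f y * h x ∂(surfaceMeasure R) ∂(surfaceMeasure R) :=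
        integral_integral_swap hprod
    _ = ∫ y, f y * v y ∂(surfaceMeasure R) := by
        congr 1
        funext y
        rw [← integral_greenFunction_mul_screened hR hL hv2 y, ← integral_const_mul]
        congr 1
        funext x
        ring

lemma IsWeakSolution.ae_eq {R L : ℝ} (hR : 0 < R) (hL : 0 < L) {f ψ ψ' : Sph R → ℝ}
    (hψ : IsWeakSolution R L f ψ) (hψ' : IsWeakSolution R L f ψ') :
    ψ =ᵐ[surfaceMeasure R] ψ' := by
  have := isFiniteMeasure_surfaceMeasure hR
  have h1 := hψ.1.integrable one_le_two
  have h2 := hψ'.1.integrable one_le_two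
  have h := ae_eq_zero_of_forall_integral_mul_screened hR hL (h1.sub h2) fun v hv => by
    have hc : Continuous fun x => laplaceBeltrami R v x - v x / L ^ 2 :=
      (continuous_laplaceBeltrami hR (hv.of_le two_le_smooth)).sub
        ((hv.continuous hR).div_const _)
    simp only [Pi.sub_apply, sub_mul]
    rw [integral_sub (h1.mul_continuous_surfaceMeasure hc) (h2.mul_continuous_surfaceMeasure hc),
      hψ.2 v hv, hψ'.2 v hv, sub_self]
  filter_upwards [h] with x hx
  exact sub_eq_zero.1 hx

end WeakSolutions

theorem mainTheorem1 (R L : ℝ) (hR : 0 < R) (hL : 0 < L) :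
    ∃ G : Sph R → Sph R → ℝ,
      IsGreenFunction R L G ∧
      (∀ G' : Sph R → Sph R → ℝ, IsGreenFunction R L G' → ∀ x y, x ≠ y → G' x y = G x y) ∧
      (∀ f : Sph R → ℝ, MemLp f 2 (surfaceMeasure R) →
        (∀ x, Integrable (fun y => G x y * f y) (surfaceMeasure R)) ∧
        IsWeakSolution R L f (fun x => ∫ y, G x y * f y ∂(surfaceMeasure R)) ∧
        ∀ ψ : Sph R → ℝ, IsWeakSolution R L f ψ →
          ψ =ᵐ[surfaceMeasure R] fun x => ∫ y, G x y * f y ∂(surfaceMeasure R)) ∧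
      (∀ f ψ : Sph R → ℝ, SphereContDiff R 2 ψ →
        (∀ x, laplaceBeltrami R ψ x - ψ x / L ^ 2 = f x) →
          ∀ x, ψ x = ∫ y, G x y * f y ∂(surfaceMeasure R)) ∧
      (∀ x y, x ≠ y →
        Tendsto (fun N => greenPartialSum R L N x y) atTop (𝓝 (G x y))) ∧
      (∀ x, Tendsto (fun N => greenPartialSum R L N x x) atTop atBot) := by
  refine ⟨greenFunction R L, isGreenFunction_greenFunction hR hL, fun G' hG' x y hxy =>
    (isGreenFunction_greenFunction hR hL).eq_off_diagonal hR hL hG' hxy,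
    fun f hf => ⟨integrable_greenFunction_mul hR hL hf, isWeakSolution_greenPotential hR hL hf,
      fun ψ hψ => hψ.ae_eq hR hL (isWeakSolution_greenPotential hR hL hf)⟩,
    fun f ψ hψ h x => ?_, fun x y hxy => tendsto_greenPartialSum hR hL hxy,
    tendsto_greenPartialSum_self hR hL⟩
  simp_rw [greenFunction_comm R L x, ← h]
  exact (integral_greenFunction_mul_screened hR hL hψ x).symm
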